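/- Let $0<\alpha<2$, let $K\ge 2$, and let $F_1,\dots,F_K$ be probability distributions on $\mathbb R^d$ with finite second moments that are not all equal, i.e. $F_j\ne F_k$ for some $j<k$. For finite samples $A=(a_1,\dots,a_m)$ and $B=(b_1,\dots,b_l)$ in $\mathbb R^d$ put $$g_\alpha(A,B)=\frac1{ml}\sum_{i=1}^m\sum_{r=1}^l\|a_i-b_r\|^\alpha,\qquad d_\alpha(A,B)=\frac{ml}{m+l}\bigl[2g_\alpha(A,B)-g_\alpha(A,A)-g_\alpha(B,B)\bigr],$$ where $\|\cdot\|$ is the Euclidean norm. For samples $A_1,\dots,A_K$ of sizes $n_1,\dots,n_K$, with $N=n_1+\dots+n_K$, put $$S_\alpha=\sum_{1\le j<k\le K}\frac{n_j+n_k}{2N}\,d_\alpha(A_j,A_k),\qquad W_\alpha=\sum_{j=1}^K\frac{n_j}{2}\,g_\alpha(A_j,A_j),\qquad F_\alpha=\frac{S_\alpha/(K-1)}{W_\alpha/(N-K)}\in[0,\infty],$$ where a ratio with denominator $0$ is $\infty$ if its numerator is positive and $0$ if its numerator is $0$. Let $A_1,\dots,A_K$ be independent random samples, $A_j$ consisting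 of $n_j$ independent observations from $F_j$, and let the sample sizes grow along a sequence in such a way that $n_j\to\infty$ and $n_j/N\to p_j$ for every $j$, where $0<p_j<1$ and $\sum_j p_j=1$. Then: 1. for every constant $c>0$, $\;P(F_\alpha>c)\to1$; 2. the DISCO test of the hypothesis $F_1=\dots=F_K$ is consistent: for every significance level $a\in(0,1)$ and every probability distribution $G$ on $\mathbb R^d$, if $c_{a}=c_a(n_1,\dots,n_K;G)$ denotes the upper $a$-quantile of the null distribution of $F_\alpha$ (its distribution when all $N$ observations are independent with common distribution $G$), that is, $c_a=\inf\{c\in[0,\infty]:P_G(F_\alpha>c)\le a\}$, then $P(F_\alpha>c_a)\to1$. -/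

import Mathlib

open MeasureTheory ProbabilityTheory Filter Topology
open scoped ENNReal

noncomputable section

namespace Disco

/-- The Gini mean `g_α(A, B) = (1 / (m l)) ∑_i ∑_j ‖a_i - b_j‖ ^ α` of two samples of points
of `ℝ^d`, with the Euclidean norm. -/
def gini {d m l : ℕ} (α : ℝ) (a : Fin m → EuclideanSpace ℝ (Fin d))
    (b : Fin l → EuclideanSpace ℝ (Fin d)) : ℝ :=
  (1 / ((m : ℝ) * (l : ℝ))) * ∑ i, ∑ j, ‖a i - b j‖ ^ α

/-- The `d_α`-distance between two samples. -/
def sampleDist {d m l : ℕ} (α : ℝ) (a : Fin m → EuclideanSpace ℝ (Fin d))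
    (b : Fin l → EuclideanSpace ℝ (Fin d)) : ℝ :=
  ((m : ℝ) * (l : ℝ) / ((m : ℝ) + (l : ℝ))) * (2 * gini α a b - gini α a a - gini α b b)

/-- The total sample size `N = n_1 + ⋯ + n_K`. -/
def totalSize {K : ℕ} (n : Fin K → ℕ) : ℕ := ∑ j, n j

/-- The between-sample dispersion
`S_α = ∑_{j < k} ((n_j + n_k) / (2 N)) d_α(A_j, A_k)` of the samples `A_j = A j`. -/
def between {d K : ℕ} {n : Fin K → ℕ} (α : ℝ)
    (A : (j : Fin K) → Fin (n j) → EuclideanSpace ℝ (Fin d)) : ℝ :=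
  ∑ j, ∑ k ∈ Finset.Ioi j,
    (((n j : ℝ) + (n k : ℝ)) / (2 * (totalSize n : ℝ))) * sampleDist α (A j) (A k)

/-- The within-sample dispersion `W_α = ∑_j (n_j / 2) g_α(A_j, A_j)`. -/
def within {d K : ℕ} {n : Fin K → ℕ} (α : ℝ)
    (A : (j : Fin K) → Fin (n j) → EuclideanSpace ℝ (Fin d)) : ℝ :=
  ∑ j, ((n j : ℝ) / 2) * gini α (A j) (A j)

/-- The DISCO ratio `F_α = (S_α / (K - 1)) / (W_α / (N - K))`, with values in `[0, ∞]`.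
Numerator and denominator are nonnegative for `0 < α ≤ 2`. When the denominator vanishes the
division of `ℝ≥0∞` gives `∞` for a positive numerator and `0` for the numerator `0`. -/
def ratio {d K : ℕ} {n : Fin K → ℕ} (α : ℝ)
    (A : (j : Fin K) → Fin (n j) → EuclideanSpace ℝ (Fin d)) : ℝ≥0∞ :=
  ENNReal.ofReal (between α A / ((K : ℝ) - 1)) /
    ENNReal.ofReal (within α A / ((totalSize n : ℝ) - (K : ℝ)))

/-- The probability that `F_α` exceeds `c` when all `N` observations are independent with the
same law `G`: the upper tail of the null distribution of `F_α`. -/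
def nullTail {d K : ℕ} (n : Fin K → ℕ) (α : ℝ) (G : Measure (EuclideanSpace ℝ (Fin d)))
    (c : ℝ≥0∞) : ℝ≥0∞ :=
  (Measure.pi fun _ : (Σ j : Fin K, Fin (n j)) => G)
    {x | c < ratio α fun j i => x ⟨j, i⟩}

/-- The critical value of the DISCO test at significance level `a`: the upper `a`-quantile of the
null distribution of `F_α` for the common law `G`. -/
def criticalValue {d K : ℕ} (n : Fin K → ℕ) (α : ℝ) (G : Measure (EuclideanSpace ℝ (Fin d)))
    (a : ℝ) : ℝ≥0∞ :=
  sInf {c : ℝ≥0∞ | nullTail n α G c ≤ ENNReal.ofReal a}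

end Disco

end

/-! Two estimates suffice: under the alternative `ratio` exceeds every fixed level with probability
tending to 1, while under any common law the critical value stays bounded. Both are explicit
finite-sample bounds, so no limit theorem is needed.

Power. Up to a constant, ‖x‖^α is the integral of 1 - cos⟪x, v⟫ against a stable Lévy measure. Hence
the energy distance of two samples dominates the squared L² distance of their empirical
characteristic functions, taken in a finite measure ρ of full support
(`exists_measure_integral_empirical_le`). The empirical functions have mean squared error of order
1/n, and the limits of two different laws are at positive distance δ (`integral_sq_sub_pos`). So S
is at least of order N off an event of small probability. Second moments give W a mean of order at
most N, so the ratio, which carries a factor N - K, exceeds any c (`exists_sampleLaw_ratio_le`).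

Critical values. No moments of G are available, so S is divided by the pooled sum H of all ‖x_s -
x_r‖^α. Under G the observations are exchangeable, so all off-diagonal terms divided by H have the
same mean, at most 1/(N(N-1)). As S + W = H/(2N) (`between_add_within`), the mean of S/H is computed
exactly, and Markov's inequality gives a tail bound free of G (`nullTail_le`). -/

namespace Disco

open scoped RealInnerProductSpace

/-! ### Lévy–Khintchine representation of ‖x‖^α. -/

section Levy

open Module Set

variable {E : Type*} [NormedAddCommGroup E] [InnerProductSpace ℝ E]

/-- The density of the Lévy measure of the isotropic `α`-stable law, up to a constant factor. -/
noncomputable def stableWeight (E : Type*) [NormedAddCommGroup E] [InnerProductSpace ℝ E]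
    (α : ℝ) (v : E) : ℝ :=
  ‖v‖ ^ (-((finrank ℝ E : ℝ) + α))

/-- The integrand of the Lévy–Khintchine representation of `‖x‖ ^ α`. -/
noncomputable def stableIntegrand (α : ℝ) (x v : E) : ℝ :=
  (1 - Real.cos ⟪x, v⟫) * stableWeight E α v

lemma stableWeight_nonneg (α : ℝ) (v : E) : 0 ≤ stableWeight E α v := by
  unfold stableWeight; positivity

lemma stableIntegrand_nonneg (α : ℝ) (x v : E) : 0 ≤ stableIntegrand α x v :=
  mul_nonneg (sub_nonneg.2 (Real.cos_le_one _)) (stableWeight_nonneg α v)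

variable [MeasurableSpace E] [BorelSpace E]

lemma measurable_stableWeight (α : ℝ) : Measurable (stableWeight E α) := by
  unfold stableWeight; fun_prop

variable [FiniteDimensional ℝ E]

lemma measurable_stableIntegrand (α : ℝ) (x : E) : Measurable (stableIntegrand α x) := by
  unfold stableIntegrand
  have := measurable_stableWeight (E := E) α
  fun_prop

/-- Integrability of `min(1, ‖v‖²)` against the Lévy measure. -/
lemma integrable_min_one_sq_mul_stableWeight [Nontrivial E] {α : ℝ} (h₀ : 0 < α) (h₂ : α < 2) :
    Integrable (fun v : E => min 1 (‖v‖ ^ 2) * stableWeight E α v) := by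
  have hd : 1 ≤ finrank ℝ E := finrank_pos
  refine (integrable_fun_norm_addHaar (volume : Measure E)
    (f := fun r : ℝ => min 1 (r ^ 2) * r ^ (-((finrank ℝ E : ℝ) + α)))).2 ?_
  have key : ∀ r : ℝ, 0 < r → r ^ (finrank ℝ E - 1) * r ^ (-((finrank ℝ E : ℝ) + α))
      = r ^ (-1 - α) := by
    intro r hr
    rw [← Real.rpow_natCast, ← Real.rpow_add hr, Nat.cast_sub hd]
    congr 1
    push_cast
    ring
  -- In polar coordinates the integrand is r^(1-α) near 0, which needs α < 2, and r^(-1-α) at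
  -- infinity, which needs α > 0.
  rw [← Ioc_union_Ioi_eq_Ioi (zero_le_one (α := ℝ))]
  refine IntegrableOn.union ?_ ?_
  · have h1 : IntegrableOn (fun r : ℝ => r ^ (1 - α)) (Ioc 0 1) :=
      (intervalIntegrable_iff_integrableOn_Ioc_of_le zero_le_one).1
        (intervalIntegral.intervalIntegrable_rpow' (by linarith))
    refine h1.congr_fun (fun r hr => ?_) measurableSet_Ioc
    have hr2 : r ^ 2 ≤ 1 := by
      have := hr.1
      have := hr.2
      nlinarith
    simp only [smul_eq_mul]
    rw [min_eq_right hr2, mul_left_comm, key r hr.1, ← Real.rpow_natCast, ← Real.rpow_add hr.1]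
    congr 1
    push_cast
    ring
  · have h1 : IntegrableOn (fun r : ℝ => r ^ (-1 - α)) (Ioi 1) :=
      integrableOn_Ioi_rpow_of_lt (by linarith) zero_lt_one
    refine h1.congr_fun (fun r hr => ?_) measurableSet_Ioi
    have hr1 : 1 < r := hr
    have hr2 : 1 ≤ r ^ 2 := by nlinarith
    simp only [smul_eq_mul]
    rw [min_eq_left hr2, one_mul, key r (by linarith)]

lemma integrable_stableIntegrand [Nontrivial E] {α : ℝ} (h₀ : 0 < α) (h₂ : α < 2) (x : E) :
    Integrable (stableIntegrand α x) := by
  refine ((integrable_min_one_sq_mul_stableWeight (E := E) h₀ h₂).const_mul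
    (2 + ‖x‖ ^ 2)).mono' (measurable_stableIntegrand α x).aestronglyMeasurable
    (Eventually.of_forall fun v => ?_)
  rw [Real.norm_of_nonneg (stableIntegrand_nonneg α x v), ← mul_assoc]
  refine mul_le_mul_of_nonneg_right ?_ (stableWeight_nonneg α v)
  have h1 := Real.one_sub_sq_div_two_le_cos (x := ⟪x, v⟫)
  have h2 := Real.neg_one_le_cos ⟪x, v⟫
  have h3 : ⟪x, v⟫ ^ 2 ≤ ‖x‖ ^ 2 * ‖v‖ ^ 2 := by
    rw [← mul_pow, ← sq_abs]
    exact pow_le_pow_left₀ (abs_nonneg _) (abs_real_inner_le_norm x v) 2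
  rcases min_cases 1 (‖v‖ ^ 2) with ⟨h, -⟩ | ⟨h, -⟩ <;> rw [h]
  · nlinarith [sq_nonneg ‖x‖]
  · nlinarith [sq_nonneg ‖x‖, sq_nonneg ‖v‖]

/-- The Lévy measure is rotation invariant, so x may be replaced by ‖x‖u. Rescaling v then gives
‖x‖^(dim + α) from the homogeneous weight and ‖x‖^(-dim) from the Jacobian. -/
lemma integral_stableIntegrand_eq (α : ℝ) {u x : E} (hu : ‖u‖ = 1) (hx : x ≠ 0) :
    ∫ v, stableIntegrand α x v = ‖x‖ ^ α * ∫ v, stableIntegrand α u v := by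
  have hr : 0 < ‖x‖ := norm_pos_iff.2 hx
  set r := ‖x‖ with hrdef
  obtain ⟨φ, hφ⟩ : ∃ φ : E ≃ₗᵢ[ℝ] E, φ (r • u) = x :=
    ⟨_, Submodule.reflection_sub (by rw [norm_smul, hu, Real.norm_of_nonneg hr.le, mul_one])⟩
  have h1 : ∫ v, stableIntegrand α x v = ∫ v, stableIntegrand α x (φ v) :=
    (φ.measurePreserving.integral_comp φ.toHomeomorph.measurableEmbedding _).symm
  have h2 : ∀ v : E, stableIntegrand α x (φ v)
      = r ^ ((finrank ℝ E : ℝ) + α) * stableIntegrand α u (r • v) := by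
    intro v
    unfold stableIntegrand stableWeight
    rw [← hφ, φ.inner_map_map, φ.norm_map, real_inner_smul_left, real_inner_smul_right,
      norm_smul, Real.norm_of_nonneg hr.le, Real.mul_rpow hr.le (norm_nonneg _),
      Real.rpow_neg hr.le]
    have : r ^ ((finrank ℝ E : ℝ) + α) ≠ 0 := (Real.rpow_pos_of_pos hr _).ne'
    field_simp
  rw [h1]
  simp_rw [h2]
  rw [integral_const_mul, Measure.integral_comp_smul, abs_of_pos (by positivity), smul_eq_mul,
    Real.rpow_add hr, Real.rpow_natCast]
  field_simp

/-- The function `‖x‖ ^ α` is a constant multiple of an integral of `1 - cos ⟪x, v⟫`. -/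
lemma exists_integral_stableIntegrand_eq [Nontrivial E] {α : ℝ} (h₀ : 0 < α) (h₂ : α < 2) :
    ∃ κ : ℝ, 0 < κ ∧ ∀ x : E, ∫ v, stableIntegrand α x v = κ * ‖x‖ ^ α := by
  obtain ⟨u, hu⟩ := exists_norm_eq E zero_le_one
  refine ⟨∫ v, stableIntegrand α u v, ?_, fun x => ?_⟩
  · refine lt_of_le_of_ne (integral_nonneg (stableIntegrand_nonneg α u)) fun h => ?_
    have h1 := (integral_eq_zero_iff_of_nonneg (stableIntegrand_nonneg α u)
      (integrable_stableIntegrand h₀ h₂ u)).1 h.symm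
    have h2 : (fun v : E => Real.cos ⟪u, v⟫) =ᵐ[volume] fun _ => 1 := by
      filter_upwards [h1, compl_mem_ae_iff.2 (measure_singleton (0 : E))] with v hv hv0
      have : 0 < stableWeight E α v := Real.rpow_pos_of_pos (norm_pos_iff.2 hv0) _
      have hv' : (1 - Real.cos ⟪u, v⟫) * stableWeight E α v = 0 := hv
      rcases mul_eq_zero.1 hv' with h | h
      · linarith
      · exact absurd h this.ne'
    have h3 := (Continuous.ae_eq_iff_eq volume (by fun_prop) (by fun_prop)).1 h2
    -- A cosine equal to 1 almost everywhere is 1 everywhere by continuity, but at v = πu it is cos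
    -- π = -1.
    have h4 := congrFun h3 (Real.pi • u)
    simp only [real_inner_smul_right, real_inner_self_eq_norm_sq, hu] at h4
    norm_num at h4
  · by_cases hx : x = 0
    · subst hx
      simp [stableIntegrand, Real.zero_rpow h₀.ne']
    · rw [integral_stableIntegrand_eq α hu hx, mul_comm]

end Levy

/-! ### Strict negative definiteness of the kernel ‖x - y‖^α. -/

section Weighted

open Module

/-- Weights of total mass zero kill the constant 1; what remains is minus |∑ w_i exp(iθ_i)|². -/
lemma sum_mul_mul_one_sub_cos {ι : Type*} [Fintype ι] (w θ : ι → ℝ) (hw : ∑ i, w i = 0) :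
    ∑ i, ∑ j, w i * w j * (1 - Real.cos (θ i - θ j))
      = -((∑ i, w i * Real.cos (θ i)) ^ 2 + (∑ i, w i * Real.sin (θ i)) ^ 2) := by
  have h : ∀ i j, w i * w j * (1 - Real.cos (θ i - θ j))
      = w i * w j - (w i * Real.cos (θ i)) * (w j * Real.cos (θ j))
        - (w i * Real.sin (θ i)) * (w j * Real.sin (θ j)) := by
    intro i j
    rw [Real.cos_sub]
    ring
  simp_rw [h, Finset.sum_sub_distrib, ← Finset.mul_sum, ← Finset.sum_mul, hw]
  ring

/-- The kernel `‖x - y‖ ^ α` is conditionally negative definite, strictly so in the sense that the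
quadratic form dominates an integral of squared characteristic functions. -/
lemma exists_measure_integral_le {E : Type*} [NormedAddCommGroup E] [InnerProductSpace ℝ E]
    [FiniteDimensional ℝ E] [MeasurableSpace E] [BorelSpace E] [Nontrivial E]
    {α : ℝ} (h₀ : 0 < α) (h₂ : α < 2) :
    ∃ ρ : Measure E, IsFiniteMeasure ρ ∧ ρ.IsOpenPosMeasure ∧
      ∀ {ι : Type} [Fintype ι] (w : ι → ℝ) (x : ι → E), ∑ i, w i = 0 →
        ∫ v, ((∑ i, w i * Real.cos ⟪x i, v⟫) ^ 2 + (∑ i, w i * Real.sin ⟪x i, v⟫) ^ 2) ∂ρ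
          ≤ -∑ i, ∑ j, w i * w j * ‖x i - x j‖ ^ α := by
  obtain ⟨κ, hκ, hrep⟩ := exists_integral_stableIntegrand_eq (E := E) h₀ h₂
  -- The Lévy density is not integrable at 0. Replacing ‖v‖ by 1 + ‖v‖ makes it smaller but
  -- integrable and still positive everywhere; the identity becomes an inequality in the direction
  -- needed.
  set q : E → ℝ := fun v => κ⁻¹ * (1 + ‖v‖) ^ (-((finrank ℝ E : ℝ) + α)) with hq
  have hqpos : ∀ v, 0 < q v := fun v => by positivity
  have hqm : Measurable q := by fun_prop
  have hqint : Integrable q :=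
    (integrable_one_add_norm (by linarith)).const_mul _
  refine ⟨volume.withDensity fun v => ENNReal.ofReal (q v), ?_, ?_, ?_⟩
  · exact isFiniteMeasure_withDensity_ofReal hqint.2
  · refine (withDensity_absolutelyContinuous' (by fun_prop) ?_).isOpenPosMeasure
    exact Eventually.of_forall fun v => (ENNReal.ofReal_pos.2 (hqpos v)).ne'
  intro ι _ w x hw
  have hid : ∀ v, (∑ i, w i * Real.cos ⟪x i, v⟫) ^ 2 + (∑ i, w i * Real.sin ⟪x i, v⟫) ^ 2
      = -∑ i, ∑ j, w i * w j * (1 - Real.cos ⟪x i - x j, v⟫) := by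
    intro v
    simp_rw [inner_sub_left]
    rw [sum_mul_mul_one_sub_cos w (fun i => ⟪x i, v⟫) hw, neg_neg]
  have hR : -∑ i, ∑ j, w i * w j * ‖x i - x j‖ ^ α
      = ∫ v, κ⁻¹ * -∑ i, ∑ j, w i * w j * stableIntegrand α (x i - x j) v := by
    rw [integral_const_mul, integral_neg, integral_finsetSum]
    · rw [mul_neg, Finset.mul_sum]
      congr 1
      refine Finset.sum_congr rfl fun i _ => ?_
      rw [integral_finsetSum, Finset.mul_sum]
      · refine Finset.sum_congr rfl fun j _ => ?_
        rw [integral_const_mul, hrep]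
        field_simp
      · exact fun j _ => (integrable_stableIntegrand h₀ h₂ _).const_mul _
    · exact fun i _ => integrable_finsetSum _ fun j _ =>
        (integrable_stableIntegrand h₀ h₂ _).const_mul _
  rw [hR, integral_withDensity_eq_integral_toReal_smul (by fun_prop)
    (Eventually.of_forall fun v => ENNReal.ofReal_lt_top)]
  refine integral_mono_of_nonneg (Eventually.of_forall fun v => ?_) ?_ ?_
  · simp only [Pi.zero_apply, smul_eq_mul]
    positivity
  · refine Integrable.const_mul (Integrable.neg ?_) _
    exact integrable_finsetSum _ fun i _ => integrable_finsetSum _ fun j _ =>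
        (integrable_stableIntegrand h₀ h₂ _).const_mul _
  · filter_upwards [compl_mem_ae_iff.2 (measure_singleton (0 : E))] with v hv
    have hv0 : 0 < ‖v‖ := norm_pos_iff.2 hv
    have h1 : ∑ i, ∑ j, w i * w j * stableIntegrand α (x i - x j) v
        = (∑ i, ∑ j, w i * w j * (1 - Real.cos ⟪x i - x j, v⟫)) * stableWeight E α v := by
      simp_rw [Finset.sum_mul, stableIntegrand, mul_assoc]
    have h2 : q v ≤ κ⁻¹ * stableWeight E α v := by
      refine mul_le_mul_of_nonneg_left ?_ (by positivity)
      exact Real.rpow_le_rpow_of_nonpos hv0 (by linarith) (by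
        have : (0 : ℝ) ≤ finrank ℝ E := by positivity
        linarith)
    simp only [ENNReal.toReal_ofReal (hqpos v).le, smul_eq_mul]
    rw [h1, ← neg_mul, ← hid v, mul_left_comm, mul_comm]
    exact mul_le_mul_of_nonneg_left h2 (by positivity)

end Weighted

/-! ### Energy distance of samples and pooled dispersion. -/

/-- Real part of the empirical characteristic function. -/
noncomputable def empiricalCos {d m : ℕ} (a : Fin m → EuclideanSpace ℝ (Fin d))
    (v : EuclideanSpace ℝ (Fin d)) : ℝ :=
  (1 / (m : ℝ)) * ∑ i, Real.cos ⟪a i, v⟫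

/-- Imaginary part of the empirical characteristic function. -/
noncomputable def empiricalSin {d m : ℕ} (a : Fin m → EuclideanSpace ℝ (Fin d))
    (v : EuclideanSpace ℝ (Fin d)) : ℝ :=
  (1 / (m : ℝ)) * ∑ i, Real.sin ⟪a i, v⟫

lemma gini_comm {d m l : ℕ} (α : ℝ) (a : Fin m → EuclideanSpace ℝ (Fin d))
    (b : Fin l → EuclideanSpace ℝ (Fin d)) : gini α a b = gini α b a := by
  unfold gini
  rw [Finset.sum_comm, mul_comm (m : ℝ)]
  simp_rw [norm_sub_rev]

/-- The sample energy distance dominates an integrated squared distance of the empirical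
characteristic functions. -/
lemma exists_measure_integral_empirical_le {d : ℕ} [NeZero d] {α : ℝ} (h₀ : 0 < α) (h₂ : α < 2) :
    ∃ ρ : Measure (EuclideanSpace ℝ (Fin d)), IsFiniteMeasure ρ ∧ ρ.IsOpenPosMeasure ∧
      ∀ {m l : ℕ}, 0 < m → 0 < l → ∀ (a : Fin m → EuclideanSpace ℝ (Fin d))
        (b : Fin l → EuclideanSpace ℝ (Fin d)),
        ∫ v, ((empiricalCos a v - empiricalCos b v) ^ 2
            + (empiricalSin a v - empiricalSin b v) ^ 2) ∂ρ
          ≤ 2 * gini α a b - gini α a a - gini α b b := by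
  obtain ⟨ρ, hfin, hpos, h⟩ :=
    exists_measure_integral_le (E := EuclideanSpace ℝ (Fin d)) h₀ h₂
  refine ⟨ρ, hfin, hpos, fun {m l} hm hl a b => ?_⟩
  have hm' : (m : ℝ) ≠ 0 := by positivity
  have hl' : (l : ℝ) ≠ 0 := by positivity
  -- The weights are those of the difference of the two empirical measures, which has total mass
  -- zero.
  have key := h (Sum.elim (fun _ : Fin m => 1 / (m : ℝ)) (fun _ : Fin l => -(1 / (l : ℝ))))
    (Sum.elim a b) (by simp [hm', hl'])
  simp only [Fintype.sum_sum_type, Sum.elim_inl, Sum.elim_inr, ← Finset.mul_sum,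
    Finset.sum_add_distrib] at key
  have hba : gini α b a = gini α a b := gini_comm α b a
  unfold gini at hba ⊢
  unfold empiricalCos empiricalSin
  convert key using 1
  · congr 1
    ext v
    ring
  · have e1 : 1 / (m : ℝ) * -(1 / (l : ℝ)) = -(1 / ((m : ℝ) * l)) := by field_simp
    have e2 : -(1 / (l : ℝ)) * (1 / (m : ℝ)) = -(1 / ((l : ℝ) * m)) := by field_simp
    have e3 : -(1 / (l : ℝ)) * -(1 / (l : ℝ)) = 1 / ((l : ℝ) * l) := by field_simp
    rw [e1, e2, e3, neg_mul, neg_mul, hba]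
    ring

lemma gini_nonneg {d m l : ℕ} (α : ℝ) (a : Fin m → EuclideanSpace ℝ (Fin d))
    (b : Fin l → EuclideanSpace ℝ (Fin d)) : 0 ≤ gini α a b := by
  unfold gini; positivity

lemma within_nonneg {d K : ℕ} {n : Fin K → ℕ} (α : ℝ)
    (A : (j : Fin K) → Fin (n j) → EuclideanSpace ℝ (Fin d)) : 0 ≤ within α A :=
  Finset.sum_nonneg fun j _ => mul_nonneg (by positivity) (gini_nonneg α _ _)

lemma sampleDist_nonneg {d m l : ℕ} [NeZero d] {α : ℝ} (h₀ : 0 < α) (h₂ : α < 2)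
    (hm : 0 < m) (hl : 0 < l) (a : Fin m → EuclideanSpace ℝ (Fin d))
    (b : Fin l → EuclideanSpace ℝ (Fin d)) : 0 ≤ sampleDist α a b := by
  obtain ⟨ρ, -, -, h⟩ := exists_measure_integral_empirical_le (d := d) h₀ h₂
  refine mul_nonneg (by positivity) (le_trans (integral_nonneg fun v => ?_) (h hm hl a b))
  simp only [Pi.zero_apply]
  positivity

lemma between_nonneg {d K : ℕ} [NeZero d] {n : Fin K → ℕ} {α : ℝ} (h₀ : 0 < α) (h₂ : α < 2)
    (hn : ∀ j, 0 < n j) (A : (j : Fin K) → Fin (n j) → EuclideanSpace ℝ (Fin d)) :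
    0 ≤ between α A :=
  Finset.sum_nonneg fun j _ => Finset.sum_nonneg fun k _ =>
    mul_nonneg (by positivity) (sampleDist_nonneg h₀ h₂ (hn j) (hn k) _ _)

lemma sum_sum_Ioi_eq_half_sum {K : ℕ} (f : Fin K → Fin K → ℝ) (hsymm : ∀ j k, f j k = f k j)
    (hdiag : ∀ j, f j j = 0) : ∑ j, ∑ k ∈ Finset.Ioi j, f j k = (∑ j, ∑ k, f j k) / 2 := by
  have h := Finset.sum_sum_Ioi_add_eq_sum_sum_off_diag f
  have h1 : ∀ j, ∑ k ∈ {j}ᶜ, f k j = ∑ k, f j k := by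
    intro j
    rw [Fintype.sum_eq_add_sum_compl j (f j), hdiag, zero_add]
    exact Finset.sum_congr rfl fun k _ => hsymm k j
  have h2 : ∀ j, ∑ k ∈ Finset.Ioi j, (f k j + f j k) = 2 * ∑ k ∈ Finset.Ioi j, f j k := by
    intro j
    rw [Finset.mul_sum]
    exact Finset.sum_congr rfl fun k _ => by rw [hsymm k j]; ring
  simp_rw [h1, h2, ← Finset.mul_sum] at h
  linarith

/-- The decomposition of the total dispersion of the pooled sample. -/
lemma between_add_within {d K : ℕ} {n : Fin K → ℕ} (α : ℝ) (hn : ∀ j, 0 < n j) (hK : 0 < K)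
    (x : (Σ j : Fin K, Fin (n j)) → EuclideanSpace ℝ (Fin d)) :
    between α (fun j i => x ⟨j, i⟩) + within α (fun j i => x ⟨j, i⟩)
      = (∑ s, ∑ r, ‖x s - x r‖ ^ α) / (2 * (totalSize n : ℝ)) := by
  have hn' : ∀ j, (0 : ℝ) < n j := fun j => by exact_mod_cast hn j
  set N : ℝ := (totalSize n : ℝ) with hN
  have hNsum : N = ∑ j, (n j : ℝ) := by simp [hN, totalSize]
  have hNpos : 0 < N := by
    rw [hNsum]
    exact Finset.sum_pos (fun j _ => hn' j) ⟨⟨0, hK⟩, Finset.mem_univ _⟩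
  set g : Fin K → Fin K → ℝ := fun j k => gini α (fun i => x ⟨j, i⟩) (fun i => x ⟨k, i⟩) with hg
  have hgs : ∀ j k, g j k = g k j := fun j k => gini_comm α _ _
  -- The factor n_j + n_k in S cancels the denominator of d_α, leaving a summand symmetric in j, k
  -- and zero on the diagonal.
  have hB : between α (fun j i => x ⟨j, i⟩)
      = ∑ j, ∑ k ∈ Finset.Ioi j, (n j * n k) * (2 * g j k - g j j - g k k) / (2 * N) := by
    refine Finset.sum_congr rfl fun j _ => Finset.sum_congr rfl fun k _ => ?_
    have := hn' j
    have := hn' k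
    unfold sampleDist
    rw [← hN]
    field_simp
    simp only [hg]
  have hH : ∑ s, ∑ r, ‖x s - x r‖ ^ α = ∑ j, ∑ k, (n j * n k) * g j k := by
    rw [Fintype.sum_sigma]
    refine Finset.sum_congr rfl fun j _ => ?_
    simp_rw [Fintype.sum_sigma]
    rw [Finset.sum_comm]
    refine Finset.sum_congr rfl fun k _ => ?_
    have := hn' j
    have := hn' k
    simp only [hg, gini]
    field_simp
  have e1 : ∑ j, ∑ k, (n j * n k : ℝ) * g j j = N * ∑ j, n j * g j j := by
    rw [Finset.mul_sum]
    refine Finset.sum_congr rfl fun j _ => ?_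
    rw [← Finset.sum_mul, ← Finset.mul_sum, ← hNsum]
    ring
  have e2 : ∑ j, ∑ k, (n j * n k : ℝ) * g k k = N * ∑ j, n j * g j j := by
    rw [Finset.sum_comm, ← e1]
    exact Finset.sum_congr rfl fun j _ => Finset.sum_congr rfl fun k _ => by ring
  have e3 : within α (fun j i => x ⟨j, i⟩) = (∑ j, n j * g j j) / 2 := by
    rw [Finset.sum_div]
    exact Finset.sum_congr rfl fun j _ => by simp only [hg]; ring
  have e4 : ∑ j, ∑ k, (n j * n k : ℝ) * (2 * g j k - g j j - g k k)
      = 2 * (∑ j, ∑ k, (n j * n k : ℝ) * g j k) - 2 * (N * ∑ j, n j * g j j) := by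
    rw [two_mul (N * _)]
    nth_rewrite 2 [← e1]
    rw [← e2]
    simp_rw [mul_sub, Finset.sum_sub_distrib, Finset.mul_sum]
    rw [sub_sub]
    congr 1
    · exact Finset.sum_congr rfl fun j _ => Finset.sum_congr rfl fun k _ => by ring
    · exact add_comm _ _
  rw [hB, hH, e3, sum_sum_Ioi_eq_half_sum _ (fun j k => by rw [hgs j k]; ring)
    (fun j => by ring)]
  simp_rw [← Finset.sum_div]
  rw [e4]
  field_simp
  ring

/-! ### Measurability of the statistics. -/

section Measurability

variable {d K : ℕ} {n : Fin K → ℕ} (α : ℝ)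

@[fun_prop]
lemma measurable_gini (j k : Fin K) :
    Measurable fun x : (Σ j : Fin K, Fin (n j)) → EuclideanSpace ℝ (Fin d) =>
      gini α (fun i => x ⟨j, i⟩) (fun i => x ⟨k, i⟩) := by
  unfold gini; fun_prop

lemma measurable_within :
    Measurable fun x : (Σ j : Fin K, Fin (n j)) → EuclideanSpace ℝ (Fin d) =>
      within α fun j i => x ⟨j, i⟩ := by
  unfold within; fun_prop

lemma measurable_between :
    Measurable fun x : (Σ j : Fin K, Fin (n j)) → EuclideanSpace ℝ (Fin d) =>
      between α fun j i => x ⟨j, i⟩ := by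
  unfold between sampleDist; fun_prop

lemma measurable_ratio :
    Measurable fun x : (Σ j : Fin K, Fin (n j)) → EuclideanSpace ℝ (Fin d) =>
      ratio α fun j i => x ⟨j, i⟩ := by
  have := measurable_within (d := d) (n := n) α
  have := measurable_between (d := d) (n := n) α
  unfold ratio; fun_prop

end Measurability

/-- Clearing denominators replaces the `ℝ≥0∞` quotient by a real inequality that remains correct
when W = 0. -/
lemma ratio_le_ofReal_iff {d K : ℕ} {n : Fin K → ℕ} {α c : ℝ} (hK : 1 < K)
    (hN : K < totalSize n) (hc : 0 < c)
    (A : (j : Fin K) → Fin (n j) → EuclideanSpace ℝ (Fin d)) :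
    ratio α A ≤ ENNReal.ofReal c ↔
      between α A * ((totalSize n : ℝ) - K) ≤ c * ((K : ℝ) - 1) * within α A := by
  have hK' : (0 : ℝ) < (K : ℝ) - 1 := sub_pos.2 (by exact_mod_cast hK)
  have hN' : (0 : ℝ) < (totalSize n : ℝ) - K := sub_pos.2 (by exact_mod_cast hN)
  have hW := within_nonneg α A
  unfold ratio
  rw [ENNReal.div_le_iff_le_mul (Or.inr ENNReal.ofReal_ne_top)
    (Or.inr (ENNReal.ofReal_pos.2 hc).ne'), ← ENNReal.ofReal_mul hc.le,
    ENNReal.ofReal_le_ofReal_iff (by positivity), div_le_iff₀ hK']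
  rw [← mul_le_mul_iff_left₀ hN']
  have : c * (within α A / ((totalSize n : ℝ) - K)) * ((K : ℝ) - 1) * ((totalSize n : ℝ) - K)
      = c * ((K : ℝ) - 1) * within α A := by
    field_simp
  rw [this]

/-! ### Self-normalized sums of exchangeable terms. -/

section Exchangeable

variable {ι S : Type*} [Fintype ι] [MeasurableSpace S]

lemma integrable_div_sum (G : Measure S) [IsProbabilityMeasure G] {h : S → S → ℝ}
    (hm : Measurable (Function.uncurry h)) (hpos : ∀ x y, 0 ≤ h x y) (s r : ι) :
    Integrable (fun x : ι → S => h (x s) (x r) / ∑ i, ∑ j, h (x i) (x j))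
      (Measure.pi fun _ => G) := by
  have hmeas : ∀ i j, Measurable fun x : ι → S => h (x i) (x j) := fun i j =>
    show Measurable (Function.uncurry h ∘ fun x : ι → S => (x i, x j)) from
      hm.comp ((measurable_pi_apply i).prodMk (measurable_pi_apply j))
  refine Integrable.of_bound (C := 1) ?_ (Eventually.of_forall fun x => ?_)
  · exact ((hmeas s r).div (Finset.measurable_sum _ fun i _ =>
      Finset.measurable_sum _ fun j _ => hmeas i j)).aestronglyMeasurable
  · have h1 : h (x s) (x r) ≤ ∑ i, ∑ j, h (x i) (x j) :=
      (Finset.single_le_sum (f := fun j => h (x s) (x j)) (fun j _ => hpos _ _)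
        (Finset.mem_univ r)).trans
      (Finset.single_le_sum (f := fun i => ∑ j, h (x i) (x j))
        (fun i _ => Finset.sum_nonneg fun j _ => hpos _ _) (Finset.mem_univ s))
    rw [Real.norm_of_nonneg (div_nonneg (hpos _ _) ((hpos _ _).trans h1))]
    exact div_le_one_of_le₀ h1 ((hpos _ _).trans h1)

/-- Under a product of identical laws, all off-diagonal self-normalized kernel terms have the
same expectation. -/
lemma integral_div_sum_eq (G : Measure S) [IsProbabilityMeasure G] (h : S → S → ℝ)
    {s r s' r' : ι} (hsr : s ≠ r) (hsr' : s' ≠ r') :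
    ∫ x : ι → S, h (x s) (x r) / ∑ i, ∑ j, h (x i) (x j) ∂(Measure.pi fun _ => G)
      = ∫ x : ι → S, h (x s') (x r') / ∑ i, ∑ j, h (x i) (x j) ∂(Measure.pi fun _ => G) := by
  classical
  -- Some permutation carries one ordered pair of distinct indices to the other; it preserves both
  -- the product law and the full double sum.
  obtain ⟨σ, h1, h2⟩ := MulAction.is_two_pretransitive_iff.1
    (Equiv.Perm.isMultiplyPretransitive ι 2) hsr' hsr
  simp only [Equiv.Perm.smul_def] at h1 h2
  have hmp := measurePreserving_piCongrLeft (fun _ : ι => G) σ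
  rw [← hmp.integral_comp (MeasurableEquiv.measurableEmbedding _)]
  refine integral_congr_ae (Eventually.of_forall fun x => ?_)
  have hx : ∀ i, MeasurableEquiv.piCongrLeft (fun _ => S) σ x (σ i) = x i := fun i =>
    Equiv.piCongrLeft_apply_apply (fun _ => S) σ x i
  simp only
  rw [← h1, ← h2, hx, hx]
  congr 1
  rw [← Equiv.sum_comp σ]
  refine Finset.sum_congr rfl fun i _ => ?_
  rw [← Equiv.sum_comp σ]
  simp_rw [hx]

/-- The quotients add up to 1 where the double sum is nonzero and, since division by 0 gives 0, to 0
elsewhere. Diagonal terms vanish and the others share one mean. -/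
lemma card_mul_integral_div_sum_eq (G : Measure S) [IsProbabilityMeasure G] {h : S → S → ℝ}
    (hm : Measurable (Function.uncurry h)) (hpos : ∀ x y, 0 ≤ h x y) (hdiag : ∀ x, h x x = 0)
    {s r : ι} (hsr : s ≠ r) :
    (Fintype.card ι : ℝ) * ((Fintype.card ι : ℝ) - 1) *
      ∫ x : ι → S, h (x s) (x r) / ∑ i, ∑ j, h (x i) (x j) ∂(Measure.pi fun _ => G)
        = (Measure.pi fun _ : ι => G).real {x | ∑ i, ∑ j, h (x i) (x j) ≠ 0} := by
  classical
  set e := ∫ x : ι → S, h (x s) (x r) / ∑ i, ∑ j, h (x i) (x j) ∂(Measure.pi fun _ => G) with he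
  have hmeas : Measurable fun x : ι → S => ∑ i, ∑ j, h (x i) (x j) :=
    Finset.measurable_sum _ fun i _ => Finset.measurable_sum _ fun j _ =>
      show Measurable (Function.uncurry h ∘ fun x : ι → S => (x i, x j)) from
        hm.comp ((measurable_pi_apply i).prodMk (measurable_pi_apply j))
  have hset : MeasurableSet {x : ι → S | ∑ i, ∑ j, h (x i) (x j) ≠ 0} :=
    (hmeas (measurableSet_singleton 0)).compl
  have h1 : ∀ i j : ι, ∫ x : ι → S, h (x i) (x j) / ∑ i, ∑ j, h (x i) (x j)
      ∂(Measure.pi fun _ => G) = if i = j then 0 else e := by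
    intro i j
    split_ifs with hij
    · subst hij; simp [hdiag]
    · exact integral_div_sum_eq G h hij hsr
  rw [← integral_indicator_one hset]
  have h2 : ({x : ι → S | ∑ i, ∑ j, h (x i) (x j) ≠ 0}.indicator 1 : (ι → S) → ℝ)
      = fun x => ∑ a, ∑ b, h (x a) (x b) / ∑ i, ∑ j, h (x i) (x j) := by
    ext x
    simp_rw [← Finset.sum_div]
    by_cases hx : ∑ i, ∑ j, h (x i) (x j) = 0
    · simp [hx]
    · rw [div_self hx, Set.indicator_of_mem (by exact hx)]
      rfl
  rw [h2, integral_finsetSum _ fun a _ => integrable_finsetSum _ fun b _ =>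
    integrable_div_sum G hm hpos a b]
  have h3 : ∀ a, ∫ x : ι → S, ∑ b, h (x a) (x b) / ∑ i, ∑ j, h (x i) (x j)
      ∂(Measure.pi fun _ => G) = ((Fintype.card ι : ℝ) - 1) * e := by
    intro a
    rw [integral_finsetSum _ fun b _ => integrable_div_sum G hm hpos a b]
    simp_rw [h1]
    rw [← Finset.sum_erase_add _ _ (Finset.mem_univ a), if_pos rfl, add_zero,
      Finset.sum_congr rfl (fun b hb => if_neg (Finset.ne_of_mem_erase hb).symm),
      Finset.sum_const, Finset.card_erase_of_mem (Finset.mem_univ a), nsmul_eq_mul,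
      Finset.card_univ, Nat.cast_pred (Fintype.card_pos_iff.2 ⟨a⟩)]
  simp_rw [h3]
  simp [mul_assoc]

end Exchangeable

/-! ### Null distribution. -/

/-- Under the null hypothesis, `S_α` normalized by the pooled dispersion has expectation of order
`1 / N²`, without any moment assumption. -/
lemma integral_between_div_le {d K : ℕ} {n : Fin K → ℕ} {α : ℝ} (h₀ : 0 < α)
    (hn : ∀ j, 0 < n j) (hK : 1 < K) (G : Measure (EuclideanSpace ℝ (Fin d)))
    [IsProbabilityMeasure G] :
    Integrable (fun x : (Σ j : Fin K, Fin (n j)) → EuclideanSpace ℝ (Fin d) =>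
      between α (fun j i => x ⟨j, i⟩) / ∑ s, ∑ r, ‖x s - x r‖ ^ α) (Measure.pi fun _ => G) ∧
    ∫ x : (Σ j : Fin K, Fin (n j)) → EuclideanSpace ℝ (Fin d),
      between α (fun j i => x ⟨j, i⟩) / ∑ s, ∑ r, ‖x s - x r‖ ^ α ∂(Measure.pi fun _ => G)
      ≤ ((K : ℝ) - 1) / (2 * totalSize n * ((totalSize n : ℝ) - 1)) := by
  classical
  have hn' : ∀ j, (0 : ℝ) < n j := fun j => by exact_mod_cast hn j
  set N : ℝ := (totalSize n : ℝ) with hN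
  have hcard : (Fintype.card (Σ j : Fin K, Fin (n j)) : ℝ) = N := by
    simp [hN, totalSize]
  have hNsum : N = ∑ j, (n j : ℝ) := by simp [hN, totalSize]
  have hKN : (K : ℝ) ≤ N := by
    rw [hNsum]
    calc (K : ℝ) = ∑ j : Fin K, (1 : ℝ) := by simp
      _ ≤ _ := Finset.sum_le_sum fun j _ => by exact_mod_cast hn j
  have hK1 : (1 : ℝ) < K := by exact_mod_cast hK
  have hm : Measurable (Function.uncurry fun a b : EuclideanSpace ℝ (Fin d) => ‖a - b‖ ^ α) := by
    unfold Function.uncurry; fun_prop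
  have hpos : ∀ a b : EuclideanSpace ℝ (Fin d), 0 ≤ ‖a - b‖ ^ α := fun a b => by positivity
  have hdiag : ∀ a : EuclideanSpace ℝ (Fin d), ‖a - a‖ ^ α = 0 := fun a => by
    simp [h₀.ne']
  set π : Measure ((Σ j : Fin K, Fin (n j)) → EuclideanSpace ℝ (Fin d)) :=
    Measure.pi fun _ => G with hπ
  have hint := integrable_div_sum (ι := Σ j : Fin K, Fin (n j)) G hm hpos
  -- The reference pair comes from two different samples, since a single sample may have only one
  -- point.
  let s₀ : Σ j : Fin K, Fin (n j) := ⟨⟨0, by omega⟩, ⟨0, hn _⟩⟩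
  let r₀ : Σ j : Fin K, Fin (n j) := ⟨⟨1, by omega⟩, ⟨0, hn _⟩⟩
  have hsr : s₀ ≠ r₀ := by
    intro h
    have := congrArg (fun t => (Sigma.fst t : Fin K).val) h
    simp [s₀, r₀] at this
  set e := ∫ x, ‖x s₀ - x r₀‖ ^ α / ∑ i, ∑ j, ‖x i - x j‖ ^ α ∂π with he
  have hcm := card_mul_integral_div_sum_eq (ι := Σ j : Fin K, Fin (n j)) G hm hpos hdiag hsr
  rw [hcard] at hcm
  set q := π.real {x | ∑ i, ∑ j, ‖x i - x j‖ ^ α ≠ 0} with hq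
  have hcm' : N * (N - 1) * e = q := hcm
  have hq1 : q ≤ 1 := measureReal_le_one
  have hterm : ∀ (j : Fin K) (i r : Fin (n j)),
      ∫ x, ‖x ⟨j, i⟩ - x ⟨j, r⟩‖ ^ α / ∑ i, ∑ j, ‖x i - x j‖ ^ α ∂π
        = if i = r then 0 else e := by
    intro j i r
    split_ifs with hir
    · subst hir; simp [h₀.ne']
    · refine integral_div_sum_eq G (fun a b => ‖a - b‖ ^ α) ?_ hsr
      simpa using hir
  have hWeq : ∀ x : (Σ j : Fin K, Fin (n j)) → EuclideanSpace ℝ (Fin d),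
      within α (fun j i => x ⟨j, i⟩) / ∑ s, ∑ r, ‖x s - x r‖ ^ α
        = ∑ j, 1 / (2 * (n j : ℝ)) * ∑ i : Fin (n j), ∑ r : Fin (n j),
          ‖x ⟨j, i⟩ - x ⟨j, r⟩‖ ^ α / ∑ s, ∑ r, ‖x s - x r‖ ^ α := by
    intro x
    simp_rw [← Finset.sum_div]
    rw [within, Finset.sum_div]
    refine Finset.sum_congr rfl fun j _ => ?_
    have := (hn' j).ne'
    unfold gini
    field_simp
  have hWint : Integrable (fun x => within α (fun j i => x ⟨j, i⟩) /
      ∑ s, ∑ r, ‖x s - x r‖ ^ α) π := by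
    simp_rw [hWeq]
    exact integrable_finsetSum _ fun j _ => (integrable_finsetSum _ fun i _ =>
      integrable_finsetSum _ fun r _ => hint _ _).const_mul _
  have hWval : ∫ x, within α (fun j i => x ⟨j, i⟩) / ∑ s, ∑ r, ‖x s - x r‖ ^ α ∂π
      = (N - K) / 2 * e := by
    simp_rw [hWeq]
    rw [integral_finsetSum _ fun j _ => (integrable_finsetSum _ fun i _ =>
      integrable_finsetSum _ fun r _ => hint _ _).const_mul _]
    have : ∀ j : Fin K, ∫ x, 1 / (2 * (n j : ℝ)) * ∑ i : Fin (n j), ∑ r : Fin (n j),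
          ‖x ⟨j, i⟩ - x ⟨j, r⟩‖ ^ α / ∑ s, ∑ r, ‖x s - x r‖ ^ α ∂π = ((n j : ℝ) - 1) / 2 * e := by
      intro j
      rw [integral_const_mul, integral_finsetSum _ fun i _ =>
        integrable_finsetSum _ fun r _ => hint _ _]
      have h3 : ∀ i : Fin (n j), ∫ x, ∑ r : Fin (n j),
          ‖x ⟨j, i⟩ - x ⟨j, r⟩‖ ^ α / ∑ s, ∑ r, ‖x s - x r‖ ^ α ∂π = ((n j : ℝ) - 1) * e := by
        intro i
        rw [integral_finsetSum _ fun r _ => hint _ _]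
        rw [Finset.sum_congr rfl fun r _ => hterm j i r]
        rw [← Finset.sum_erase_add _ _ (Finset.mem_univ i), if_pos rfl, add_zero,
          Finset.sum_congr rfl (fun b hb => if_neg (Finset.ne_of_mem_erase hb).symm),
          Finset.sum_const, Finset.card_erase_of_mem (Finset.mem_univ i), nsmul_eq_mul,
          Finset.card_univ, Fintype.card_fin, Nat.cast_sub (hn j)]
        simp
      rw [Finset.sum_congr rfl fun i _ => h3 i]
      have := (hn' j).ne'
      simp only [Finset.sum_const, Finset.card_univ, Fintype.card_fin, nsmul_eq_mul]
      field_simp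
    rw [Finset.sum_congr rfl fun j _ => this j, ← Finset.sum_mul, ← Finset.sum_div, Finset.sum_sub_distrib, ← hNsum]
    simp
  have hset : MeasurableSet {x : (Σ j : Fin K, Fin (n j)) → EuclideanSpace ℝ (Fin d) |
      ∑ i, ∑ j, ‖x i - x j‖ ^ α ≠ 0} := by
    have : Measurable fun x : (Σ j : Fin K, Fin (n j)) → EuclideanSpace ℝ (Fin d) =>
      ∑ i, ∑ j, ‖x i - x j‖ ^ α := by fun_prop
    exact (this (measurableSet_singleton 0)).compl
  -- S/H is 1/(2N) minus W/H where H ≠ 0; where H = 0 all terms are 0 by the division convention.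
  have hB : (fun x : (Σ j : Fin K, Fin (n j)) → EuclideanSpace ℝ (Fin d) =>
      between α (fun j i => x ⟨j, i⟩) / ∑ s, ∑ r, ‖x s - x r‖ ^ α)
      = fun x => 1 / (2 * N) * {x : (Σ j : Fin K, Fin (n j)) → EuclideanSpace ℝ (Fin d) |
        ∑ i, ∑ j, ‖x i - x j‖ ^ α ≠ 0}.indicator 1 x
        - within α (fun j i => x ⟨j, i⟩) / ∑ s, ∑ r, ‖x s - x r‖ ^ α := by
    ext x
    rw [eq_sub_iff_add_eq, ← add_div, between_add_within α hn (by omega) x]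
    by_cases hx : ∑ i, ∑ j, ‖x i - x j‖ ^ α = 0
    · simp [hx]
    · rw [Set.indicator_of_mem (by exact hx), Pi.one_apply, mul_one, ← hN]
      field_simp
  have hiint : Integrable (fun x => 1 / (2 * N) *
      {x : (Σ j : Fin K, Fin (n j)) → EuclideanSpace ℝ (Fin d) |
        ∑ i, ∑ j, ‖x i - x j‖ ^ α ≠ 0}.indicator (1 : ((Σ j : Fin K, Fin (n j)) → EuclideanSpace ℝ (Fin d)) → ℝ) x) π :=
    ((integrable_const (1 : ℝ)).indicator hset).const_mul _
  rw [hB]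
  refine ⟨hiint.sub hWint, ?_⟩
  rw [integral_sub hiint hWint, hWval, integral_const_mul, integral_indicator_one hset, ← hq,
    ← hcm']
  have hN1 : 0 < N - 1 := by linarith
  have hNp : 0 < N := by linarith
  have he1 : e ≤ 1 / (N * (N - 1)) := by
    rw [le_div_iff₀ (by positivity)]
    linarith
  calc 1 / (2 * N) * (N * (N - 1) * e) - (N - K) / 2 * e = ((K : ℝ) - 1) / 2 * e := by
        field_simp
        ring
    _ ≤ ((K : ℝ) - 1) / 2 * (1 / (N * (N - 1))) :=
        mul_le_mul_of_nonneg_left he1 (by linarith)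
    _ = _ := by field_simp

/-- A distribution-free bound for the upper tail of the null distribution. -/
lemma nullTail_le {d K : ℕ} [NeZero d] {n : Fin K → ℕ} {α c : ℝ} (h₀ : 0 < α) (h₂ : α < 2)
    (hn : ∀ j, 0 < n j) (hK : 1 < K) (hN : K < totalSize n) (hc : 0 < c)
    (G : Measure (EuclideanSpace ℝ (Fin d))) [IsProbabilityMeasure G] :
    nullTail n α G (ENNReal.ofReal c)
      ≤ ENNReal.ofReal (1 / c + ((K : ℝ) - 1) / ((totalSize n : ℝ) - 1)) := by
  obtain ⟨hint, hle⟩ := integral_between_div_le (d := d) h₀ hn hK G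
  have hK1 : (0 : ℝ) < (K : ℝ) - 1 := sub_pos.2 (by exact_mod_cast hK)
  have hKN : (0 : ℝ) < (totalSize n : ℝ) - K := sub_pos.2 (by exact_mod_cast hN)
  set N : ℝ := (totalSize n : ℝ) with hNdef
  have hN1 : 0 < N - 1 := by linarith
  have hNp : 0 < N := by linarith
  set π : Measure ((Σ j : Fin K, Fin (n j)) → EuclideanSpace ℝ (Fin d)) :=
    Measure.pi fun _ => G with hπ
  -- F > c forces S/(S + W) > c(K-1)/(N - K + c(K-1)); dividing by 2N turns this into a bound for
  -- S/H.
  set ε : ℝ := c * ((K : ℝ) - 1) / (2 * N * (N - K + c * ((K : ℝ) - 1))) with hε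
  have hεpos : 0 < ε := by positivity
  have hnonneg : ∀ x : (Σ j : Fin K, Fin (n j)) → EuclideanSpace ℝ (Fin d),
      0 ≤ between α (fun j i => x ⟨j, i⟩) / ∑ s, ∑ r, ‖x s - x r‖ ^ α := fun x =>
    div_nonneg (between_nonneg h₀ h₂ hn _) (by positivity)
  have hsub : {x : (Σ j : Fin K, Fin (n j)) → EuclideanSpace ℝ (Fin d) |
      ENNReal.ofReal c < ratio α fun j i => x ⟨j, i⟩}
      ⊆ {x | ε ≤ between α (fun j i => x ⟨j, i⟩) / ∑ s, ∑ r, ‖x s - x r‖ ^ α} := by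
    intro x hx
    have hx' : c * ((K : ℝ) - 1) * within α (fun j i => x ⟨j, i⟩)
        < between α (fun j i => x ⟨j, i⟩) * (N - K) := by
      rw [← not_le, ← ratio_le_ofReal_iff hK hN hc]
      exact not_le.2 hx
    have hW := within_nonneg α (fun j i => x ⟨j, i⟩)
    have hT := between_add_within α hn (by omega) x
    rw [← hNdef] at hT
    set B := between α (fun j i => x ⟨j, i⟩)
    set W := within α (fun j i => x ⟨j, i⟩)
    set H := ∑ s, ∑ r, ‖x s - x r‖ ^ α
    have hB : 0 < B := by
      by_contra hB
      have h1 : B * (N - K) ≤ 0 := mul_nonpos_of_nonpos_of_nonneg (not_lt.1 hB) hKN.le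
      have h2 : 0 ≤ c * ((K : ℝ) - 1) * W := by positivity
      linarith
    have hHeq : H = 2 * N * (B + W) := by
      rw [hT]; field_simp
    have hH : 0 < H := by rw [hHeq]; positivity
    show ε ≤ B / H
    rw [hε, div_le_div_iff₀ (by positivity) hH, hHeq]
    have : c * ((K : ℝ) - 1) * (B + W) ≤ B * (N - K + c * ((K : ℝ) - 1)) := by linarith
    nlinarith
  have hmarkov := mul_meas_ge_le_integral_of_nonneg (μ := π) (Eventually.of_forall hnonneg) hint ε
  unfold nullTail
  refine (measure_mono hsub).trans ?_
  rw [← ofReal_measureReal]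
  refine ENNReal.ofReal_le_ofReal ?_
  refine ((le_div_iff₀' hεpos).2 (hmarkov.trans hle)).trans ?_
  rw [hε]
  have e1 : ((K : ℝ) - 1) / (2 * N * (N - 1)) / (c * ((K : ℝ) - 1) /
      (2 * N * (N - K + c * ((K : ℝ) - 1)))) = (N - K) / (N - 1) * (1 / c)
        + ((K : ℝ) - 1) / (N - 1) := by
    field_simp
  rw [e1]
  have e2 : (N - K) / (N - 1) * (1 / c) ≤ 1 * (1 / c) :=
    mul_le_mul_of_nonneg_right ((div_le_one hN1).2 (by linarith)) (by positivity)
  linarith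

/-! ### Characteristic functions and their empirical versions. -/

/-- Real part of the characteristic function. -/
noncomputable def meanCos {d : ℕ} (μ : Measure (EuclideanSpace ℝ (Fin d)))
    (v : EuclideanSpace ℝ (Fin d)) : ℝ := ∫ y, Real.cos ⟪y, v⟫ ∂μ

/-- Imaginary part of the characteristic function. -/
noncomputable def meanSin {d : ℕ} (μ : Measure (EuclideanSpace ℝ (Fin d)))
    (v : EuclideanSpace ℝ (Fin d)) : ℝ := ∫ y, Real.sin ⟪y, v⟫ ∂μ

section CharFun

variable {d : ℕ} (μ : Measure (EuclideanSpace ℝ (Fin d))) [IsProbabilityMeasure μ]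

lemma continuous_meanCos : Continuous (meanCos μ) :=
  continuous_of_dominated (bound := fun _ => 1)
    (fun v => (by fun_prop : Continuous fun y : EuclideanSpace ℝ (Fin d) =>
      Real.cos ⟪y, v⟫).aestronglyMeasurable)
    (fun v => Eventually.of_forall fun y => Real.abs_cos_le_one _)
    (integrable_const _) (Eventually.of_forall fun y => by fun_prop)

lemma continuous_meanSin : Continuous (meanSin μ) :=
  continuous_of_dominated (bound := fun _ => 1)
    (fun v => (by fun_prop : Continuous fun y : EuclideanSpace ℝ (Fin d) =>
      Real.sin ⟪y, v⟫).aestronglyMeasurable)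
    (fun v => Eventually.of_forall fun y => Real.abs_sin_le_one _)
    (integrable_const _) (Eventually.of_forall fun y => by fun_prop)

lemma abs_meanCos_le_one (v : EuclideanSpace ℝ (Fin d)) : |meanCos μ v| ≤ 1 := by
  simpa [meanCos] using norm_integral_le_of_norm_le_const (μ := μ)
    (f := fun y => Real.cos ⟪y, v⟫) (Eventually.of_forall fun y => Real.abs_cos_le_one ⟪y, v⟫)

lemma abs_meanSin_le_one (v : EuclideanSpace ℝ (Fin d)) : |meanSin μ v| ≤ 1 := by
  simpa [meanSin] using norm_integral_le_of_norm_le_const (μ := μ)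
    (f := fun y => Real.sin ⟪y, v⟫) (Eventually.of_forall fun y => Real.abs_sin_le_one ⟪y, v⟫)

lemma charFun_eq_meanCos_add_meanSin (v : EuclideanSpace ℝ (Fin d)) :
    charFun μ v = meanCos μ v + meanSin μ v * Complex.I := by
  have hc : Integrable (fun y : EuclideanSpace ℝ (Fin d) => Real.cos ⟪y, v⟫) μ :=
    Integrable.of_bound (by fun_prop) 1 (Eventually.of_forall fun y => Real.abs_cos_le_one _)
  have hs : Integrable (fun y : EuclideanSpace ℝ (Fin d) => Real.sin ⟪y, v⟫) μ :=
    Integrable.of_bound (by fun_prop) 1 (Eventually.of_forall fun y => Real.abs_sin_le_one _)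
  rw [charFun_apply, meanCos, meanSin, ← integral_complex_ofReal, ← integral_complex_ofReal,
    ← integral_mul_const, ← integral_add hc.ofReal (hs.ofReal.mul_const _)]
  refine integral_congr_ae (Eventually.of_forall fun y => ?_)
  simp [Complex.exp_mul_I]

lemma eq_of_meanCos_eq_of_meanSin_eq (ν : Measure (EuclideanSpace ℝ (Fin d)))
    [IsProbabilityMeasure ν] (hc : ∀ v, meanCos μ v = meanCos ν v)
    (hs : ∀ v, meanSin μ v = meanSin ν v) : μ = ν := by
  refine Measure.ext_of_charFun (funext fun v => ?_)
  rw [charFun_eq_meanCos_add_meanSin, charFun_eq_meanCos_add_meanSin, hc, hs]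

lemma sq_sub_le_four {a b : ℝ} (ha : |a| ≤ 1) (hb : |b| ≤ 1) : (a - b) ^ 2 ≤ 4 := by
  rw [abs_le] at ha hb
  nlinarith

lemma integrable_sq_add_sq_of_abs_le_one {S : Type*} [MeasurableSpace S] (ρ : Measure S)
    [IsFiniteMeasure ρ] {f f' g g' : S → ℝ} (hf : Measurable f) (hf' : Measurable f')
    (hg : Measurable g) (hg' : Measurable g') (bf : ∀ v, |f v| ≤ 1) (bf' : ∀ v, |f' v| ≤ 1)
    (bg : ∀ v, |g v| ≤ 1) (bg' : ∀ v, |g' v| ≤ 1) :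
    Integrable (fun v => (f v - f' v) ^ 2 + (g v - g' v) ^ 2) ρ := by
  refine Integrable.of_bound (C := 8) (by fun_prop) (Eventually.of_forall fun v => ?_)
  rw [Real.norm_of_nonneg (by positivity)]
  linarith [sq_sub_le_four (bf v) (bf' v), sq_sub_le_four (bg v) (bg' v)]

/-- If the integral vanished, its continuous nonnegative integrand would vanish everywhere, because
ρ charges every nonempty open set; equal characteristic functions determine the law. -/
lemma integral_sq_sub_pos {ν : Measure (EuclideanSpace ℝ (Fin d))} [IsProbabilityMeasure ν]
    (ρ : Measure (EuclideanSpace ℝ (Fin d))) [IsFiniteMeasure ρ] [ρ.IsOpenPosMeasure]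
    (hne : μ ≠ ν) :
    0 < ∫ v, ((meanCos μ v - meanCos ν v) ^ 2 + (meanSin μ v - meanSin ν v) ^ 2) ∂ρ := by
  have c1 := continuous_meanCos μ
  have c2 := continuous_meanCos ν
  have c3 := continuous_meanSin μ
  have c4 := continuous_meanSin ν
  have hnn : ∀ v, 0 ≤ (meanCos μ v - meanCos ν v) ^ 2 + (meanSin μ v - meanSin ν v) ^ 2 :=
    fun v => by positivity
  refine lt_of_le_of_ne (integral_nonneg hnn) fun h => hne ?_
  have h1 := (integral_eq_zero_iff_of_nonneg hnn (integrable_sq_add_sq_of_abs_le_one ρ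
    c1.measurable c2.measurable c3.measurable c4.measurable (abs_meanCos_le_one μ)
    (abs_meanCos_le_one ν) (abs_meanSin_le_one μ) (abs_meanSin_le_one ν))).1 h.symm
  have h2 := (Continuous.ae_eq_iff_eq ρ (by fun_prop) continuous_zero).1 h1
  have h3 : ∀ v, (meanCos μ v - meanCos ν v) ^ 2 + (meanSin μ v - meanSin ν v) ^ 2 = 0 :=
    fun v => congrFun h2 v
  refine eq_of_meanCos_eq_of_meanSin_eq μ ν (fun v => ?_) fun v => ?_ <;>
    nlinarith [h3 v, sq_nonneg (meanCos μ v - meanCos ν v),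
      sq_nonneg (meanSin μ v - meanSin ν v)]

end CharFun

/-- The mean squared error of an average of independent variables with values in `[-1, 1]`. -/
lemma integral_sq_average_sub_le {Ω : Type*} [MeasurableSpace Ω] {P : Measure Ω}
    [IsProbabilityMeasure P] {m : ℕ} (hm : 0 < m) {Y : Fin m → Ω → ℝ}
    (hY : ∀ i, Measurable (Y i)) (hb : ∀ i ω, |Y i ω| ≤ 1)
    (hindep : Pairwise fun i j => IndepFun (Y i) (Y j) P) {θ : ℝ} (hθ : ∀ i, P[Y i] = θ) :
    ∫ ω, ((1 / (m : ℝ)) * ∑ i, Y i ω - θ) ^ 2 ∂P ≤ 1 / (m : ℝ) := by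
  have hm' : (0 : ℝ) < m := by exact_mod_cast hm
  have hL : ∀ i, MemLp (Y i) 2 P := fun i =>
    MemLp.of_bound (hY i).aestronglyMeasurable 1 (Eventually.of_forall (hb i))
  have hvar : ∀ i, variance (Y i) P ≤ 1 := by
    intro i
    refine (variance_le_expectation_sq (hY i).aestronglyMeasurable).trans ?_
    calc ∫ ω, (Y i ^ 2) ω ∂P ≤ ∫ _, (1 : ℝ) ∂P := by
          refine integral_mono (hL i).integrable_sq (integrable_const _) fun ω => ?_
          have := abs_le.1 (hb i ω)
          simp only [Pi.pow_apply]
          nlinarith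
      _ = 1 := by simp
  have hsum := IndepFun.variance_sum (μ := P) (X := Y) (s := Finset.univ) (fun i _ => hL i)
    fun i _ j _ hij => hindep hij
  have hmean : P[∑ i, Y i] = m * θ := by
    simp only [Finset.sum_apply]
    rw [integral_finsetSum _ fun i _ => (hL i).integrable one_le_two]
    simp [hθ]
  rw [variance_eq_integral (by fun_prop), hmean] at hsum
  have heq : ∀ ω, ((1 / (m : ℝ)) * ∑ i, Y i ω - θ) ^ 2
      = (1 / (m : ℝ)) ^ 2 * ((∑ i, Y i) ω - m * θ) ^ 2 := by
    intro ω
    rw [Finset.sum_apply, ← mul_pow]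
    congr 1
    field_simp
  simp_rw [heq]
  rw [integral_const_mul, hsum]
  calc (1 / (m : ℝ)) ^ 2 * ∑ i, variance (Y i) P ≤ (1 / (m : ℝ)) ^ 2 * ∑ _i : Fin m, (1 : ℝ) :=
        mul_le_mul_of_nonneg_left (Finset.sum_le_sum fun i _ => hvar i) (by positivity)
    _ = 1 / m := by
        simp
        field_simp

lemma abs_empiricalCos_le_one {d m : ℕ} (a : Fin m → EuclideanSpace ℝ (Fin d))
    (v : EuclideanSpace ℝ (Fin d)) : |empiricalCos a v| ≤ 1 := by
  unfold empiricalCos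
  rw [abs_mul, abs_of_nonneg (by positivity), one_div, inv_mul_eq_div]
  refine div_le_one_of_le₀ ((Finset.abs_sum_le_sum_abs _ _).trans ?_) (by positivity)
  refine (Finset.sum_le_sum fun i _ => Real.abs_cos_le_one _).trans ?_
  simp

lemma abs_empiricalSin_le_one {d m : ℕ} (a : Fin m → EuclideanSpace ℝ (Fin d))
    (v : EuclideanSpace ℝ (Fin d)) : |empiricalSin a v| ≤ 1 := by
  unfold empiricalSin
  rw [abs_mul, abs_of_nonneg (by positivity), one_div, inv_mul_eq_div]
  refine div_le_one_of_le₀ ((Finset.abs_sum_le_sum_abs _ _).trans ?_) (by positivity)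
  refine (Finset.sum_le_sum fun i _ => Real.abs_sin_le_one _).trans ?_
  simp

lemma measurable_empiricalCos {d m : ℕ} (a : Fin m → EuclideanSpace ℝ (Fin d)) :
    Measurable (empiricalCos a) := by
  unfold empiricalCos; fun_prop

lemma measurable_empiricalSin {d m : ℕ} (a : Fin m → EuclideanSpace ℝ (Fin d)) :
    Measurable (empiricalSin a) := by
  unfold empiricalSin; fun_prop

/-- The integrated squared distance of the empirical characteristic function from the
characteristic function of `μ`. -/
noncomputable def charFunError {d m : ℕ} (ρ μ : Measure (EuclideanSpace ℝ (Fin d)))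
    (a : Fin m → EuclideanSpace ℝ (Fin d)) : ℝ :=
  ∫ v, ((empiricalCos a v - meanCos μ v) ^ 2 + (empiricalSin a v - meanSin μ v) ^ 2) ∂ρ

lemma charFunError_nonneg {d m : ℕ} (ρ μ : Measure (EuclideanSpace ℝ (Fin d)))
    (a : Fin m → EuclideanSpace ℝ (Fin d)) : 0 ≤ charFunError ρ μ a :=
  integral_nonneg fun v => by simp only [Pi.zero_apply]; positivity

/-- A quantitative triangle inequality for characteristic functions. -/
lemma integral_sq_sub_le {d m l : ℕ} (ρ μ ν : Measure (EuclideanSpace ℝ (Fin d)))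
    [IsFiniteMeasure ρ] [IsProbabilityMeasure μ] [IsProbabilityMeasure ν]
    (a : Fin m → EuclideanSpace ℝ (Fin d)) (b : Fin l → EuclideanSpace ℝ (Fin d)) :
    ∫ v, ((meanCos μ v - meanCos ν v) ^ 2 + (meanSin μ v - meanSin ν v) ^ 2) ∂ρ
      ≤ 3 * (charFunError ρ μ a + charFunError ρ ν b
        + ∫ v, ((empiricalCos a v - empiricalCos b v) ^ 2
            + (empiricalSin a v - empiricalSin b v) ^ 2) ∂ρ) := by
  have c1 := (continuous_meanCos μ).measurable
  have c2 := (continuous_meanCos ν).measurable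
  have c3 := (continuous_meanSin μ).measurable
  have c4 := (continuous_meanSin ν).measurable
  have i0 := integrable_sq_add_sq_of_abs_le_one ρ c1 c2 c3 c4 (abs_meanCos_le_one μ)
    (abs_meanCos_le_one ν) (abs_meanSin_le_one μ) (abs_meanSin_le_one ν)
  have i1 := integrable_sq_add_sq_of_abs_le_one ρ (measurable_empiricalCos a) c1
    (measurable_empiricalSin a) c3 (abs_empiricalCos_le_one a) (abs_meanCos_le_one μ)
    (abs_empiricalSin_le_one a) (abs_meanSin_le_one μ)
  have i2 := integrable_sq_add_sq_of_abs_le_one ρ (measurable_empiricalCos b) c2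
    (measurable_empiricalSin b) c4 (abs_empiricalCos_le_one b) (abs_meanCos_le_one ν)
    (abs_empiricalSin_le_one b) (abs_meanSin_le_one ν)
  have i3 := integrable_sq_add_sq_of_abs_le_one ρ (measurable_empiricalCos a)
    (measurable_empiricalCos b) (measurable_empiricalSin a) (measurable_empiricalSin b)
    (abs_empiricalCos_le_one a) (abs_empiricalCos_le_one b) (abs_empiricalSin_le_one a)
    (abs_empiricalSin_le_one b)
  unfold charFunError
  have i12 := i1.add i2
  have i123 := i12.add i3
  simp only [Pi.add_def] at i12 i123
  rw [← integral_add i1 i2, ← integral_add i12 i3, ← integral_const_mul]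
  refine integral_mono i0 (i123.const_mul 3) fun v => ?_
  -- Here p - q = -(r - p) + (r - s) + (s - q), and the square of a sum of three terms is at most 3
  -- times the sum of their squares.
  have key : ∀ p q r s : ℝ, (p - q) ^ 2 ≤ 3 * ((r - p) ^ 2 + (s - q) ^ 2 + (r - s) ^ 2) := by
    intro p q r s
    nlinarith [sq_nonneg ((r - p) + (s - q)), sq_nonneg ((r - p) + (r - s)),
      sq_nonneg ((s - q) - (r - s)), sq_nonneg ((r - p) - (r - s))]
  have k1 := key (meanCos μ v) (meanCos ν v) (empiricalCos a v) (empiricalCos b v)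
  have k2 := key (meanSin μ v) (meanSin ν v) (empiricalSin a v) (empiricalSin b v)
  simp only
  linarith

/-! ### Moment bounds under the sampling law. -/

section Sampling

variable {d K : ℕ} {n : Fin K → ℕ} (μ : Fin K → Measure (EuclideanSpace ℝ (Fin d)))
  [∀ j, IsProbabilityMeasure (μ j)]

/-- The joint law of the independent samples. -/
noncomputable abbrev sampleLaw (n : Fin K → ℕ) :
    Measure ((Σ j : Fin K, Fin (n j)) → EuclideanSpace ℝ (Fin d)) :=
  Measure.pi fun s => μ s.1

lemma integral_sampleLaw_eval {F : Type*} [NormedAddCommGroup F] [NormedSpace ℝ F]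
    (s : Σ j : Fin K, Fin (n j)) {f : EuclideanSpace ℝ (Fin d) → F}
    (hf : AEStronglyMeasurable f (μ s.1)) :
    ∫ x, f (x s) ∂(sampleLaw μ n) = ∫ y, f y ∂(μ s.1) := by
  have h := (measurePreserving_eval (fun s : Σ j : Fin K, Fin (n j) => μ s.1) s)
  rw [← h.map_eq] at hf ⊢
  exact (integral_map (measurable_pi_apply s).aemeasurable hf).symm

lemma integral_sq_average_eval_sub_le {j : Fin K} (hn : 0 < n j)
    {f : EuclideanSpace ℝ (Fin d) → ℝ} (hf : Measurable f) (hb : ∀ y, |f y| ≤ 1) :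
    ∫ x, ((1 / (n j : ℝ)) * ∑ i, f (x ⟨j, i⟩) - ∫ y, f y ∂(μ j)) ^ 2 ∂(sampleLaw μ n)
      ≤ 1 / (n j : ℝ) := by
  have hind := iIndepFun_pi (μ := fun s : Σ j : Fin K, Fin (n j) => μ s.1)
    (X := fun _ => f) fun _ => hf.aemeasurable
  refine integral_sq_average_sub_le (P := sampleLaw μ n) hn
    (Y := fun i x => f (x ⟨j, i⟩)) (fun i => by fun_prop) (fun i x => hb _)
    (fun i r hir => hind.indepFun (by simpa using hir)) fun i => ?_
  exact integral_sampleLaw_eval μ ⟨j, i⟩ hf.aestronglyMeasurable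

/-- By Fubini it suffices to fix v, where the cosine and the sine average each have mean squared
error at most 1/n_j. -/
lemma integral_charFunError_le (ρ : Measure (EuclideanSpace ℝ (Fin d))) [IsFiniteMeasure ρ]
    {j : Fin K} (hn : 0 < n j) :
    Integrable (fun x => charFunError ρ (μ j) fun i => x ⟨j, i⟩) (sampleLaw μ n) ∧
    ∫ x, charFunError ρ (μ j) (fun i => x ⟨j, i⟩) ∂(sampleLaw μ n)
      ≤ 2 * ρ.real Set.univ / n j := by
  have c1 := (continuous_meanCos (μ j)).measurable
  have c3 := (continuous_meanSin (μ j)).measurable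
  have hint := integrable_sq_add_sq_of_abs_le_one ((sampleLaw μ n).prod ρ)
    (f := fun p => empiricalCos (fun i => p.1 ⟨j, i⟩) p.2)
    (f' := fun p => meanCos (μ j) p.2)
    (g := fun p => empiricalSin (fun i => p.1 ⟨j, i⟩) p.2)
    (g' := fun p => meanSin (μ j) p.2)
    (by unfold empiricalCos; fun_prop) (by fun_prop)
    (by unfold empiricalSin; fun_prop) (by fun_prop)
    (fun p => abs_empiricalCos_le_one _ _) (fun p => abs_meanCos_le_one _ _)
    (fun p => abs_empiricalSin_le_one _ _) (fun p => abs_meanSin_le_one _ _)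
  refine ⟨hint.integral_prod_left, ?_⟩
  unfold charFunError
  rw [integral_integral_swap hint]
  have hv : ∀ v, ∫ x : (Σ j : Fin K, Fin (n j)) → EuclideanSpace ℝ (Fin d),
      ((empiricalCos (fun i => x ⟨j, i⟩) v - meanCos (μ j) v) ^ 2
        + (empiricalSin (fun i => x ⟨j, i⟩) v - meanSin (μ j) v) ^ 2) ∂(sampleLaw μ n)
      ≤ 2 / n j := by
    intro v
    have hi : ∀ {f : ((Σ j : Fin K, Fin (n j)) → EuclideanSpace ℝ (Fin d)) → ℝ} {θ : ℝ},
        Measurable f → (∀ x, |f x| ≤ 1) → |θ| ≤ 1 →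
        Integrable (fun x => (f x - θ) ^ 2) (sampleLaw μ n) := by
      intro f θ hf bf bθ
      refine Integrable.of_bound (C := 4) (by fun_prop) (Eventually.of_forall fun x => ?_)
      rw [Real.norm_of_nonneg (by positivity)]
      exact sq_sub_le_four (bf x) bθ
    rw [integral_add
      (hi (by unfold empiricalCos; fun_prop) (fun x => abs_empiricalCos_le_one _ v)
        (abs_meanCos_le_one _ v))
      (hi (by unfold empiricalSin; fun_prop) (fun x => abs_empiricalSin_le_one _ v)
        (abs_meanSin_le_one _ v))]
    have h1 := integral_sq_average_eval_sub_le μ hn (f := fun y => Real.cos ⟪y, v⟫)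
      (by fun_prop) fun y => Real.abs_cos_le_one _
    have h2 := integral_sq_average_eval_sub_le μ hn (f := fun y => Real.sin ⟪y, v⟫)
      (by fun_prop) fun y => Real.abs_sin_le_one _
    calc _ ≤ 1 / (n j : ℝ) + 1 / n j := add_le_add h1 h2
      _ = 2 / n j := by ring
  calc _ ≤ ∫ _, 2 / (n j : ℝ) ∂ρ := integral_mono hint.integral_prod_right (integrable_const _) hv
    _ = _ := by simp; ring

/-- From t^α ≤ 1 + t² and ‖a - b‖² ≤ 2‖a‖² + 2‖b‖². The bound is additive over observations, so its
mean is at most of order N. -/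
lemma within_le_sum {α : ℝ} (h₀ : 0 < α) (h₂ : α < 2) (hn : ∀ j, 0 < n j)
    (x : (Σ j : Fin K, Fin (n j)) → EuclideanSpace ℝ (Fin d)) :
    within α (fun j i => x ⟨j, i⟩) ≤ ∑ s, (1 / 2 + 2 * ‖x s‖ ^ 2) := by
  rw [Fintype.sum_sigma]
  refine Finset.sum_le_sum fun j _ => ?_
  have hn' : (0 : ℝ) < n j := by exact_mod_cast hn j
  have hb : ∀ a b : EuclideanSpace ℝ (Fin d), ‖a - b‖ ^ α ≤ 1 + 2 * ‖a‖ ^ 2 + 2 * ‖b‖ ^ 2 := by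
    intro a b
    have h1 : ‖a - b‖ ^ 2 ≤ 2 * ‖a‖ ^ 2 + 2 * ‖b‖ ^ 2 := by
      have := norm_sub_le a b
      nlinarith [norm_nonneg (a - b), sq_nonneg (‖a‖ - ‖b‖), norm_nonneg a, norm_nonneg b]
    rcases le_total ‖a - b‖ 1 with h | h
    · have := Real.rpow_le_one (norm_nonneg _) h h₀.le
      nlinarith [sq_nonneg ‖a‖, sq_nonneg ‖b‖]
    · have := Real.rpow_le_rpow_of_exponent_le h h₂.le
      rw [Real.rpow_two] at this
      linarith
  calc (n j : ℝ) / 2 * gini α (fun i => x ⟨j, i⟩) (fun i => x ⟨j, i⟩)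
      = 1 / (2 * n j) * ∑ i, ∑ r, ‖x ⟨j, i⟩ - x ⟨j, r⟩‖ ^ α := by
        unfold gini; field_simp
    _ ≤ 1 / (2 * n j) * ∑ i : Fin (n j), ∑ r : Fin (n j),
          (1 + 2 * ‖x ⟨j, i⟩‖ ^ 2 + 2 * ‖x ⟨j, r⟩‖ ^ 2) :=
        mul_le_mul_of_nonneg_left (Finset.sum_le_sum fun i _ => Finset.sum_le_sum fun r _ =>
          hb _ _) (by positivity)
    _ = _ := by
        simp only [Finset.sum_add_distrib, Finset.sum_const, Finset.card_univ, Fintype.card_fin,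
          nsmul_eq_mul, ← Finset.mul_sum]
        field_simp
        ring

lemma integral_sum_sq_le (hmom : ∀ j, MemLp id 2 (μ j)) :
    Integrable (fun x => ∑ s, (1 / 2 + 2 * ‖x s‖ ^ 2)) (sampleLaw μ n) ∧
    ∫ x, ∑ s, (1 / 2 + 2 * ‖x s‖ ^ 2) ∂(sampleLaw μ n)
      ≤ totalSize n * ∑ j, (1 / 2 + 2 * ∫ y, ‖y‖ ^ 2 ∂(μ j)) := by
  have hsq : ∀ j, Integrable (fun y : EuclideanSpace ℝ (Fin d) => 2 * ‖y‖ ^ 2) (μ j) :=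
    fun j => ((hmom j).integrable_norm_pow two_ne_zero).const_mul 2
  have hi : ∀ j, Integrable (fun y : EuclideanSpace ℝ (Fin d) => 1 / 2 + 2 * ‖y‖ ^ 2) (μ j) :=
    fun j => (integrable_const _).add (hsq j)
  have hs : ∀ s : Σ j : Fin K, Fin (n j),
      Integrable (fun x => 1 / 2 + 2 * ‖x s‖ ^ 2) (sampleLaw μ n) := fun s =>
    (measurePreserving_eval (fun s : Σ j : Fin K, Fin (n j) => μ s.1) s).integrable_comp_of_integrable
      (hi s.1)
  refine ⟨integrable_finsetSum _ fun s _ => hs s, ?_⟩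
  rw [integral_finsetSum _ fun s _ => hs s]
  have h1 : ∀ s : Σ j : Fin K, Fin (n j), ∫ x, (1 / 2 + 2 * ‖x s‖ ^ 2) ∂(sampleLaw μ n)
      ≤ ∑ j, (1 / 2 + 2 * ∫ y, ‖y‖ ^ 2 ∂(μ j)) := by
    intro s
    rw [integral_sampleLaw_eval μ s (f := fun y => 1 / 2 + 2 * ‖y‖ ^ 2) (by fun_prop),
      integral_add (integrable_const _) (hsq s.1), integral_const_mul]
    simp only [integral_const, probReal_univ, one_smul]
    exact Finset.single_le_sum (f := fun j => 1 / 2 + 2 * ∫ y, ‖y‖ ^ 2 ∂(μ j))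
      (fun j _ => by
        have : 0 ≤ ∫ y, ‖y‖ ^ 2 ∂(μ j) := integral_nonneg fun y => by
          simp only [Pi.zero_apply]; positivity
        positivity) (Finset.mem_univ s.1)
  refine (Finset.sum_le_sum fun s _ => h1 s).trans ?_
  simp [totalSize]

end Sampling

/-! ### Power under the alternative. -/

/-- A single pair of samples bounds the between-sample dispersion from below. -/
lemma le_between {d K : ℕ} [NeZero d] {n : Fin K → ℕ} {α : ℝ} (h₀ : 0 < α) (h₂ : α < 2)
    (hn : ∀ j, 0 < n j) (A : (j : Fin K) → Fin (n j) → EuclideanSpace ℝ (Fin d))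
    {j k : Fin K} (hjk : j < k) :
    (n j * n k : ℝ) / (2 * totalSize n) *
      (2 * gini α (A j) (A k) - gini α (A j) (A j) - gini α (A k) (A k)) ≤ between α A := by
  have hj : (0 : ℝ) < n j := by exact_mod_cast hn j
  have hk : (0 : ℝ) < n k := by exact_mod_cast hn k
  have hnn : ∀ j k : Fin K, 0 ≤ (((n j : ℝ) + (n k : ℝ)) / (2 * (totalSize n : ℝ))) *
      sampleDist α (A j) (A k) := fun j k =>
    mul_nonneg (by positivity) (sampleDist_nonneg h₀ h₂ (hn j) (hn k) _ _)
  calc _ = (((n j : ℝ) + (n k : ℝ)) / (2 * (totalSize n : ℝ))) * sampleDist α (A j) (A k) := by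
        unfold sampleDist
        field_simp
    _ ≤ ∑ k ∈ Finset.Ioi j, (((n j : ℝ) + (n k : ℝ)) / (2 * (totalSize n : ℝ))) *
          sampleDist α (A j) (A k) :=
        Finset.single_le_sum (f := fun k => (((n j : ℝ) + (n k : ℝ)) / (2 * (totalSize n : ℝ))) *
          sampleDist α (A j) (A k)) (fun k _ => hnn j k) (Finset.mem_Ioi.2 hjk)
    _ ≤ between α A :=
        Finset.single_le_sum (f := fun j => ∑ k ∈ Finset.Ioi j,
          (((n j : ℝ) + (n k : ℝ)) / (2 * (totalSize n : ℝ))) * sampleDist α (A j) (A k))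
          (fun j _ => Finset.sum_nonneg fun k _ => hnn j k) (Finset.mem_univ j)

/-- A non-asymptotic bound for the probability that the DISCO ratio is small, when two of the
sampled laws differ. -/
lemma exists_sampleLaw_ratio_le {d K : ℕ} [NeZero d] {α : ℝ} (h₀ : 0 < α) (h₂ : α < 2)
    (μ : Fin K → Measure (EuclideanSpace ℝ (Fin d))) [∀ j, IsProbabilityMeasure (μ j)]
    (hmom : ∀ j, MemLp id 2 (μ j)) {j k : Fin K} (hjk : j < k) (hne : μ j ≠ μ k) :
    ∃ C₁ C₂ : ℝ, ∀ (n : Fin K → ℕ) (c : ℝ), 0 < c → (∀ j, 0 < n j) → K < totalSize n →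
      (sampleLaw μ n).real {x | ratio α (fun j i => x ⟨j, i⟩) ≤ ENNReal.ofReal c}
        ≤ C₁ * (1 / (n j : ℝ) + 1 / (n k : ℝ))
          + C₂ * c * (totalSize n : ℝ) ^ 2 / (((totalSize n : ℝ) - K) * (n j * n k)) := by
  obtain ⟨ρ, _, _, hρ⟩ := exists_measure_integral_empirical_le (d := d) h₀ h₂
  set δ := ∫ v, ((meanCos (μ j) v - meanCos (μ k) v) ^ 2
    + (meanSin (μ j) v - meanSin (μ k) v) ^ 2) ∂ρ with hδ
  have hδpos : 0 < δ := integral_sq_sub_pos (μ j) ρ hne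
  set M := ∑ j, (1 / 2 + 2 * ∫ y, ‖y‖ ^ 2 ∂(μ j)) with hM
  have hK : 1 < K := by omega
  have hK1 : (0 : ℝ) < (K : ℝ) - 1 := sub_pos.2 (by exact_mod_cast hK)
  refine ⟨12 * ρ.real Set.univ / δ, 12 * ((K : ℝ) - 1) * M / δ, fun n c hc hn hN => ?_⟩
  have hj : (0 : ℝ) < n j := by exact_mod_cast hn j
  have hk : (0 : ℝ) < n k := by exact_mod_cast hn k
  have hKN : (0 : ℝ) < (totalSize n : ℝ) - K := sub_pos.2 (by exact_mod_cast hN)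
  obtain ⟨zj, hzj⟩ := integral_charFunError_le μ (n := n) ρ (hn j)
  obtain ⟨zk, hzk⟩ := integral_charFunError_le μ (n := n) ρ (hn k)
  obtain ⟨zw, hzw⟩ := integral_sum_sq_le μ (n := n) hmom
  rw [← hM] at hzw
  set N : ℝ := (totalSize n : ℝ) with hNdef
  have hNpos : 0 < N := by linarith
  -- Chosen so that c(K-1)τ = (N-K) · n_j n_k/(2N) · δ/6: with energy distance at least δ/6, F ≤ c
  -- is impossible once W < τ.
  set τ : ℝ := (N - K) * (n j * n k) * δ / (12 * N * c * ((K : ℝ) - 1)) with hτ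
  have hτpos : 0 < τ := by positivity
  set Z : ((Σ j : Fin K, Fin (n j)) → EuclideanSpace ℝ (Fin d)) → ℝ := fun x =>
    charFunError ρ (μ j) (fun i => x ⟨j, i⟩) + charFunError ρ (μ k) (fun i => x ⟨k, i⟩) with hZ
  set V : ((Σ j : Fin K, Fin (n j)) → EuclideanSpace ℝ (Fin d)) → ℝ := fun x =>
    ∑ s, (1 / 2 + 2 * ‖x s‖ ^ 2) with hV
  have hZint : Integrable Z (sampleLaw μ n) := zj.add zk
  have hsub : {x : (Σ j : Fin K, Fin (n j)) → EuclideanSpace ℝ (Fin d) |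
      ratio α (fun j i => x ⟨j, i⟩) ≤ ENNReal.ofReal c}
      ⊆ {x | δ / 6 ≤ Z x} ∪ {x | τ ≤ V x} := by
    intro x hx
    by_contra hcon
    rw [Set.mem_union, not_or] at hcon
    have hz : Z x < δ / 6 := not_le.1 hcon.1
    have hv : V x < τ := not_le.1 hcon.2
    have hr := (ratio_le_ofReal_iff hK hN hc (fun j i => x ⟨j, i⟩)).1 hx
    have hw : within α (fun j i => x ⟨j, i⟩) ≤ V x := within_le_sum h₀ h₂ hn x
    have htri := integral_sq_sub_le ρ (μ j) (μ k) (fun i => x ⟨j, i⟩) (fun i => x ⟨k, i⟩)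
    have hen := hρ (hn j) (hn k) (fun i => x ⟨j, i⟩) (fun i => x ⟨k, i⟩)
    have hbt := le_between h₀ h₂ hn (fun j i => x ⟨j, i⟩) hjk
    have hz' : charFunError ρ (μ j) (fun i => x ⟨j, i⟩)
      + charFunError ρ (μ k) (fun i => x ⟨k, i⟩) < δ / 6 := hz
    rw [← hδ] at htri
    -- The triangle inequality gives δ ≤ 3(Z + D), D being the energy distance; Z < δ/6 leaves more
    -- than δ/6 for D.
    have hD : δ / 6 ≤ 2 * gini α (fun i => x ⟨j, i⟩) (fun i => x ⟨k, i⟩)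
        - gini α (fun i => x ⟨j, i⟩) (fun i => x ⟨j, i⟩)
        - gini α (fun i => x ⟨k, i⟩) (fun i => x ⟨k, i⟩) := by linarith
    have hB : (n j * n k : ℝ) / (2 * N) * (δ / 6) ≤ between α (fun j i => x ⟨j, i⟩) :=
      (mul_le_mul_of_nonneg_left hD (by positivity)).trans hbt
    have h1 : (n j * n k : ℝ) / (2 * N) * (δ / 6) * (N - K)
        < c * ((K : ℝ) - 1) * τ := by
      calc _ ≤ between α (fun j i => x ⟨j, i⟩) * (N - K) :=
            mul_le_mul_of_nonneg_right hB hKN.le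
        _ ≤ c * ((K : ℝ) - 1) * within α (fun j i => x ⟨j, i⟩) := hr
        _ < _ := mul_lt_mul_of_pos_left (hw.trans_lt hv) (by positivity)
    refine absurd h1 (not_lt.2 (le_of_eq ?_))
    rw [hτ]
    field_simp
    ring
  have m1 := mul_meas_ge_le_integral_of_nonneg (Eventually.of_forall fun x =>
    add_nonneg (charFunError_nonneg ρ (μ j) _) (charFunError_nonneg ρ (μ k) _)) hZint (δ / 6)
  have m2 := mul_meas_ge_le_integral_of_nonneg (f := V) (Eventually.of_forall fun x => by
    simp only [Pi.zero_apply, hV]; positivity) zw τ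
  have i1 : ∫ x, Z x ∂(sampleLaw μ n)
      ≤ 2 * ρ.real Set.univ / n j + 2 * ρ.real Set.univ / n k := by
    rw [hZ, integral_add zj zk]
    exact add_le_add hzj hzk
  calc _ ≤ (sampleLaw μ n).real ({x | δ / 6 ≤ Z x} ∪ {x | τ ≤ V x}) := measureReal_mono hsub
    _ ≤ (sampleLaw μ n).real {x | δ / 6 ≤ Z x} + (sampleLaw μ n).real {x | τ ≤ V x} :=
        measureReal_union_le _ _
    _ ≤ (2 * ρ.real Set.univ / n j + 2 * ρ.real Set.univ / n k) / (δ / 6) + N * M / τ :=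
        add_le_add ((le_div_iff₀' (by positivity)).2 (m1.trans i1))
          ((le_div_iff₀' hτpos).2 (m2.trans hzw))
    _ = _ := by
        rw [hτ]
        field_simp
        ring

/-! ### Asymptotics along the sequence of sample sizes. -/

lemma tendsto_totalSize {K : ℕ} {n : ℕ → Fin K → ℕ} (j : Fin K)
    (hn : Tendsto (fun t => n t j) atTop atTop) :
    Tendsto (fun t => (totalSize (n t) : ℝ)) atTop atTop :=
  tendsto_natCast_atTop_atTop.comp (tendsto_atTop_mono
    (fun t => Finset.single_le_sum (f := fun j => n t j) (fun _ _ => Nat.zero_le _)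
      (Finset.mem_univ j)) hn)

lemma eventually_pos_and_lt_totalSize {K : ℕ} {n : ℕ → Fin K → ℕ} (j : Fin K)
    (hn : ∀ j, Tendsto (fun t => n t j) atTop atTop) :
    ∀ᶠ t in atTop, (∀ j, 0 < n t j) ∧ K < totalSize (n t) := by
  have h1 : ∀ᶠ t in atTop, ∀ j, 0 < n t j :=
    eventually_all.2 fun j => (hn j).eventually_gt_atTop 0
  filter_upwards [h1, (tendsto_totalSize j (hn j)).eventually_gt_atTop (K : ℝ)] with t h2 h3
  exact ⟨h2, by exact_mod_cast h3⟩

lemma tendsto_sampleLaw_ratio_le {d K : ℕ} [NeZero d] {α : ℝ} (h₀ : 0 < α) (h₂ : α < 2)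
    (μ : Fin K → Measure (EuclideanSpace ℝ (Fin d))) [∀ j, IsProbabilityMeasure (μ j)]
    (hmom : ∀ j, MemLp id 2 (μ j)) {j k : Fin K} (hjk : j < k) (hne : μ j ≠ μ k)
    {n : ℕ → Fin K → ℕ} {p : Fin K → ℝ} (hp : ∀ j, 0 < p j)
    (hn : ∀ j, Tendsto (fun t => n t j) atTop atTop)
    (hnp : ∀ j, Tendsto (fun t => (n t j : ℝ) / (totalSize (n t) : ℝ)) atTop (𝓝 (p j)))
    {c : ℝ} (hc : 0 < c) :
    Tendsto (fun t => (sampleLaw μ (n t)).real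
      {x | ratio α (fun j i => x ⟨j, i⟩) ≤ ENNReal.ofReal c}) atTop (𝓝 0) := by
  obtain ⟨C₁, C₂, hC⟩ := exists_sampleLaw_ratio_le h₀ h₂ μ hmom hjk hne
  have hinv : ∀ j, Tendsto (fun t => 1 / (n t j : ℝ)) atTop (𝓝 0) := fun j =>
    tendsto_const_nhds.div_atTop (tendsto_natCast_atTop_atTop.comp (hn j))
  have hNK : Tendsto (fun t => (totalSize (n t) : ℝ) - K) atTop atTop :=
    tendsto_atTop_add_const_right _ _ (tendsto_totalSize j (hn j))
  have hlim : Tendsto (fun t => C₁ * (1 / (n t j : ℝ) + 1 / (n t k : ℝ))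
      + C₂ * c / (((totalSize (n t) : ℝ) - K) * ((n t j : ℝ) / (totalSize (n t) : ℝ)
        * ((n t k : ℝ) / (totalSize (n t) : ℝ))))) atTop (𝓝 (C₁ * (0 + 0) + 0)) :=
    (((hinv j).add (hinv k)).const_mul C₁).add (tendsto_const_nhds.div_atTop
      (hNK.atTop_mul_pos (mul_pos (hp j) (hp k)) ((hnp j).mul (hnp k))))
  rw [add_zero, add_zero, mul_zero] at hlim
  refine squeeze_zero' (Eventually.of_forall fun t => measureReal_nonneg) ?_ hlim
  filter_upwards [eventually_pos_and_lt_totalSize j hn] with t ht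
  refine (hC (n t) c hc ht.1 ht.2).trans (le_of_eq ?_)
  have h3 : (0 : ℝ) < n t j := by exact_mod_cast ht.1 j
  have h4 : (0 : ℝ) < n t k := by exact_mod_cast ht.1 k
  have h5 : (0 : ℝ) < (totalSize (n t) : ℝ) := by
    exact_mod_cast (Nat.zero_le K).trans_lt ht.2
  have h6 : (0 : ℝ) < (totalSize (n t) : ℝ) - K := sub_pos.2 (by exact_mod_cast ht.2)
  congr 1
  field_simp

/-- The critical values of the DISCO test stay bounded, for every common law. -/
lemma eventually_criticalValue_le {d K : ℕ} [NeZero d] {α : ℝ} (h₀ : 0 < α) (h₂ : α < 2)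
    (hK : 1 < K) {n : ℕ → Fin K → ℕ} (hn : ∀ j, Tendsto (fun t => n t j) atTop atTop)
    (G : Measure (EuclideanSpace ℝ (Fin d))) [IsProbabilityMeasure G] {a : ℝ} (ha : 0 < a) :
    ∀ᶠ t in atTop, criticalValue (n t) α G a ≤ ENNReal.ofReal (2 / a) := by
  let j : Fin K := ⟨0, by omega⟩
  have hlim : Tendsto (fun t => ((K : ℝ) - 1) / ((totalSize (n t) : ℝ) - 1)) atTop (𝓝 0) :=
    tendsto_const_nhds.div_atTop
      (tendsto_atTop_add_const_right _ _ (tendsto_totalSize j (hn j)))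
  filter_upwards [eventually_pos_and_lt_totalSize j hn,
    hlim.eventually_le_const (half_pos ha)] with t ht hsmall
  refine sInf_le ((nullTail_le h₀ h₂ ht.1 hK ht.2 (by positivity) G).trans
    (ENNReal.ofReal_le_ofReal ?_))
  -- At c = 2/a the tail bound is a/2 plus a term that is eventually at most a/2.
  rw [one_div_div]
  linarith

end Disco

theorem theorem3 {d K : ℕ} (α : ℝ) (hα₀ : 0 < α) (hα₂ : α < 2)
    -- the sampled distributions, with finite second moments and not all equal
    (μ : Fin K → Measure (EuclideanSpace ℝ (Fin d))) [∀ j, IsProbabilityMeasure (μ j)]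
    (hmom : ∀ j, MemLp id 2 (μ j))
    (halt : ∃ j k, j < k ∧ μ j ≠ μ k)
    -- the sample sizes
    (n : ℕ → Fin K → ℕ) (p : Fin K → ℝ) (hp : ∀ j, 0 < p j ∧ p j < 1) (hpsum : ∑ j, p j = 1)
    (hn : ∀ j, Tendsto (fun t => n t j) atTop atTop)
    (hnp : ∀ j, Tendsto (fun t => (n t j : ℝ) / (Disco.totalSize (n t) : ℝ)) atTop (𝓝 (p j)))
    -- the independent random samples at stage `t`
    {Ω : ℕ → Type*} [∀ t, MeasurableSpace (Ω t)]
    (P : (t : ℕ) → Measure (Ω t)) [∀ t, IsProbabilityMeasure (P t)]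
    (X : (t : ℕ) → (j : Fin K) → Fin (n t j) → Ω t → EuclideanSpace ℝ (Fin d))
    (hlaw : ∀ t j i, HasLaw (X t j i) (μ j) (P t))
    (hindep : ∀ t, iIndepFun (fun s : (Σ j : Fin K, Fin (n t j)) => X t s.1 s.2) (P t)) :
    (∀ c : ℝ, 0 < c →
      Tendsto (fun t => P t {ω | ENNReal.ofReal c < Disco.ratio α fun j i => X t j i ω})
        atTop (𝓝 1)) ∧
    (∀ a : ℝ, 0 < a → a < 1 →
      ∀ G : Measure (EuclideanSpace ℝ (Fin d)), IsProbabilityMeasure G →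
        Tendsto (fun t => P t {ω | Disco.criticalValue (n t) α G a <
            Disco.ratio α fun j i => X t j i ω})
          atTop (𝓝 1)) := by
  obtain ⟨j, k, hjk, hne⟩ := halt
  have hK : 1 < K := by omega
  -- On a one-point space all probability measures coincide, so the alternative excludes d = 0.
  have : NeZero d := ⟨by
    rintro rfl
    refine hne (Measure.ext fun s _ => ?_)
    rcases Set.eq_empty_or_nonempty s with rfl | ⟨x, hx⟩
    · simp
    · have hs : s = Set.univ := Set.eq_univ_of_forall fun y => by rwa [Subsingleton.elim y x]
      simp [hs]⟩
  have hmeas : ∀ t (c : ℝ≥0∞), MeasurableSet {x : (Σ j : Fin K, Fin (n t j)) →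
      EuclideanSpace ℝ (Fin d) | c < Disco.ratio α fun j i => x ⟨j, i⟩} := fun t c =>
    measurableSet_lt measurable_const (Disco.measurable_ratio α)
  have hjoint : ∀ t, HasLaw (fun ω (s : Σ j : Fin K, Fin (n t j)) => X t s.1 s.2 ω)
      (Disco.sampleLaw μ (n t)) (P t) := fun t =>
    { aemeasurable := aemeasurable_pi_lambda _ fun s => (hlaw t s.1 s.2).aemeasurable
      map_eq := by
        rw [(iIndepFun_iff_map_fun_eq_pi_map
          fun s : Σ j : Fin K, Fin (n t j) => (hlaw t s.1 s.2).aemeasurable).1 (hindep t)]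
        simp_rw [(hlaw t _ _).map_eq] }
  have htail : ∀ t (c : ℝ≥0∞), P t {ω | c < Disco.ratio α fun j i => X t j i ω}
      = Disco.sampleLaw μ (n t) {x | c < Disco.ratio α fun j i => x ⟨j, i⟩} := fun t c =>
    (hjoint t).measure_eq (hmeas t c)
  have power : ∀ c : ℝ, 0 < c →
      Tendsto (fun t => P t {ω | ENNReal.ofReal c < Disco.ratio α fun j i => X t j i ω})
        atTop (𝓝 1) := by
    intro c hc
    have h0 := Disco.tendsto_sampleLaw_ratio_le hα₀ hα₂ μ hmom hjk hne (fun j => (hp j).1)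
      hn hnp hc
    have h1 : Tendsto (fun t => ENNReal.ofReal (1 - (Disco.sampleLaw μ (n t)).real
        {x | Disco.ratio α (fun j i => x ⟨j, i⟩) ≤ ENNReal.ofReal c})) atTop (𝓝 1) := by
      simpa using ENNReal.tendsto_ofReal (h0.const_sub 1)
    refine h1.congr fun t => ?_
    rw [htail, ← ofReal_measureReal, ← compl_compl {x | ENNReal.ofReal c < _},
      probReal_compl_eq_one_sub (hmeas t _).compl]
    simp only [Set.compl_ofPred, not_lt]
  refine ⟨power, fun a ha _ G _ => ?_⟩
  -- Eventually c_a ≤ 2/a, so the rejection event contains {F > 2/a}.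
  refine tendsto_of_tendsto_of_tendsto_of_le_of_le' (power (2 / a) (by positivity))
    tendsto_const_nhds ?_ (Eventually.of_forall fun t => prob_le_one)
  filter_upwards [Disco.eventually_criticalValue_le hα₀ hα₂ hK hn G ha] with t ht
  exact measure_mono fun ω hω => ht.trans_lt hω
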